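/- **Proposition (mBKP hierarchy).** Let $Cl$ be the complex Clifford algebra generated by neutral fermions $\phi_n$, $n\in\mathbb Z$, with $\phi_m\phi_n+\phi_n\phi_m=(-1)^m\delta_{m,-n}$. Let $\mathcal F=Cl/Cl\,(\sum_{n<0}\mathbb C\phi_n)$ and $\mathcal F^*=Cl/(\sum_{n>0}\mathbb C\phi_n)\,Cl$ be the right and left Fock spaces, with vacua $|0\rangle$ and $\langle 0|$ the classes of $1$, paired by the vacuum expectation value ($\langle 0|ab|0\rangle$ is given by Wick's theorem, with $\langle\phi_m\phi_n\rangle$ equal to $(-1)^m\delta_{m,-n}$ for $n>0$, $\tfrac12\delta_{m,0}$ for $n=0$, and $0$ for $n<0$). For odd $k\ge1$ put $H_k=\frac12\sum_{i\in\mathbb Z}(-1)^{i+1}\phi_i\phi_{-i-k}$, and $H_+(t)=\sum_{k\ge1\text{ odd}}t_kH_k$, $\xi(t,z)=\sum_{k\ge1\text{ odd}}t_kz^k$, where $t=(t_1,t_3,\dots)$ are formal variables; put $\phi(\zeta)=\sum_{k\in\mathbb Z}\phi_k\zeta^k$ and $[w]=(2w,\tfrac{2w^3}{3},\tfrac{2w^5}{5},\dots)$.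 Let $G$ be an operator from $\mathcal F$ to its completion (the dual of $\mathcal F^*$), i.e. any array of matrix elements $\langle U|G|V\rangle$ bilinear in $\langle U|\in\mathcal F^*$, $|V\rangle\in\mathcal F$ (for instance any element of $Cl$), which satisfies the basic bilinear identity $$\sum_{n\in\mathbb Z}(-1)^n\langle U|G\phi_n|V\rangle\langle U'|G\phi_{-n}|V'\rangle=\sum_{n\in\mathbb Z}(-1)^n\langle U|\phi_nG|V\rangle\langle U'|\phi_{-n}G|V'\rangle$$ for all $\langle U|,\langle U'|\in\mathcal F^*$ and $|V\rangle,|V'\rangle\in\mathcal F$ (both sums are finite). Define the formal power series in $t$ $$\tau_n(t)=\langle0|e^{H_+(t)}G|0\rangle,\qquad \tau_{n+1}(t)=2\langle0|e^{H_+(t)}\phi(\zeta)G\phi_0|0\rangle,$$ where $\tau_{n+1}$ is moreover a formal series in the parameter $\zeta$. Then, as an identity of formal power series in $t$, $t'$ for the coefficient of each power of $\zeta$, $$\oint_{C_\infty} e^{\xi(t-t',z)}\,\tau_{n+1}(t-[z^{-1}])\,\tau_n(t'+[z^{-1}])\,\frac{dz}{2\pi i z}=2\tau_n(t)\tau_{n+1}(t')-\tau_{n+1}(t)\tau_n(t'),$$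 where the integral over $C_\infty$ denotes the coefficient of $z^0$ of the integrand, expanded in powers of $t,t'$ with coefficients that are formal Laurent series in $z^{-1}$. -/

import Mathlib

namespace BKP

noncomputable section

open scoped RightActions

/-! ### Neutral fermions and their Clifford algebra -/

/-- The complex space `W_B` with basis `φ_n`, `n ∈ ℤ`. -/
abbrev W : Type := ℤ →₀ ℂ

/-- The symmetric bilinear form with `(φ_m, φ_n) ↦ (-1)^m δ_{m,-n}`. -/
def pairForm : LinearMap.BilinForm ℂ W :=
  Finsupp.linearCombination ℂ fun m : ℤ => ((-1 : ℂ) ^ m) • Finsupp.lapply (-m)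

/-- The quadratic form `v ↦ (v, v) / 2`, so that in its Clifford algebra `v w + w v = (v, w)`. -/
def Q : QuadraticForm ℂ W := ((1 / 2 : ℂ) • pairForm).toQuadraticMap

/-- The Clifford algebra `Cl(W_B)`. -/
abbrev Cl : Type := CliffordAlgebra Q

/-- The neutral fermion `φ_n`. -/
def φ (n : ℤ) : Cl := CliffordAlgebra.ι Q (Finsupp.single n 1)

lemma pairForm_single (m : ℤ) (a : ℂ) (w : W) :
    pairForm (Finsupp.single m a) w = a * ((-1 : ℂ) ^ m * w (-m)) := by
  simp [pairForm]

lemma pairForm_flip : LinearMap.flip pairForm = pairForm := by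
  refine Finsupp.lhom_ext fun m a => LinearMap.ext fun w => ?_
  induction w using Finsupp.induction_linear with
  | zero => simp
  | add f g hf hg => rw [map_add, map_add, hf, hg]
  | single n b =>
    rw [LinearMap.flip_apply, pairForm_single, pairForm_single]
    by_cases h : m = -n
    · subst h
      simp only [neg_neg, Finsupp.single_eq_same, zpow_neg, ← inv_zpow]
      norm_num
      ring
    · have h' : ¬ (n = -m) := fun h' => h (by omega)
      have h1 : (-n) ≠ m := fun h' => h (by omega)
      have h2 : (-m) ≠ n := fun h' => h (by omega)
      simp [h1.symm, h2.symm]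

lemma ι_mul_add_swap (v w : W) :
    CliffordAlgebra.ι Q v * CliffordAlgebra.ι Q w + CliffordAlgebra.ι Q w * CliffordAlgebra.ι Q v
      = algebraMap ℂ Cl (pairForm v w) := by
  rw [CliffordAlgebra.ι_mul_ι_add_swap]
  change algebraMap ℂ Cl (QuadraticMap.polar ((1 / 2 : ℂ) • pairForm).toQuadraticMap v w) = _
  rw [LinearMap.BilinMap.polar_toQuadraticMap]
  have h : pairForm w v = pairForm v w := by
    conv_lhs => rw [← pairForm_flip]
    rfl
  simp only [LinearMap.smul_apply, h, smul_eq_mul]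
  congr 1
  ring

/-- The defining relation `[φ_m, φ_n]_+ = (-1)^m δ_{m,-n}`. -/
theorem φ_anticomm (m n : ℤ) :
    φ m * φ n + φ n * φ m = algebraMap ℂ Cl (if m = -n then (-1 : ℂ) ^ m else 0) := by
  rw [φ, φ, ι_mul_add_swap, pairForm_single, Finsupp.single_apply]
  by_cases h : m = -n
  · subst h; simp
  · have h' : ¬ (n = -m) := fun h' => h (by omega)
    simp [h, h']

/-! ### Fock spaces -/

/-- The left ideal `Cl(W_B) (∑_{n<0} ℂ φ_n)`. -/
def ketIdeal : Submodule Cl Cl := Submodule.span Cl {x | ∃ n : ℤ, n < 0 ∧ x = φ n}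

/-- The right ideal `(∑_{n>0} ℂ φ_n) Cl(W_B)`. -/
def braIdeal : Submodule Clᵐᵒᵖ Cl := Submodule.span Clᵐᵒᵖ {x | ∃ n : ℤ, 0 < n ∧ x = φ n}

/-- The right Fock space `F_B`; `Cl(W_B)` acts on it from the left. -/
abbrev Ket : Type := Cl ⧸ ketIdeal

/-- The left Fock space `F_B^*`; `Cl(W_B)` acts on it from the right (`U <• a` is `⟨U| a`). -/
abbrev Bra : Type := Cl ⧸ braIdeal

/-- `|0⟩`. -/
def vacKet : Ket := Submodule.Quotient.mk 1

/-- `⟨0|`. -/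
def vacBra : Bra := Submodule.Quotient.mk 1

/-! ### Vacuum expectation and the pairing of `F_B^*` with `F_B` -/

/-- The two-point function `⟨φ_m φ_n⟩`: it is `(-1)^m δ_{m,-n}` for `n > 0`, `δ_{m,0} / 2` for
`n = 0`, and `0` for `n < 0`. -/
def twoPoint : LinearMap.BilinForm ℂ W :=
  Finsupp.linearCombination ℂ fun m : ℤ =>
    (if m < 0 then (-1 : ℂ) ^ m else if m = 0 then 1 / 2 else 0) • Finsupp.lapply (-m)

lemma twoPoint_single (m : ℤ) (a : ℂ) (w : W) :
    twoPoint (Finsupp.single m a) w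
      = a * ((if m < 0 then (-1 : ℂ) ^ m else if m = 0 then 1 / 2 else 0) * w (-m)) := by
  rw [twoPoint, Finsupp.linearCombination_single]
  rfl

lemma twoPoint_add_flip : twoPoint + LinearMap.flip twoPoint = pairForm := by
  refine Finsupp.lhom_ext fun m a => LinearMap.ext fun w => ?_
  induction w using Finsupp.induction_linear with
  | zero => simp
  | add f g hf hg => rw [map_add, map_add, hf, hg]
  | single n b =>
    rw [LinearMap.add_apply, LinearMap.add_apply, LinearMap.flip_apply, pairForm_single,
      twoPoint_single, twoPoint_single]
    by_cases h : n = -m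
    · subst h
      rcases lt_trichotomy m 0 with h | h | h
      · have h1 : ¬ (-m < 0) := by omega
        have h2 : ¬ (m = 0) := by omega
        have h3 : ¬ (-m = 0) := by omega
        simp only [h, h1, h2, h3, if_true, if_false, Finsupp.single_eq_same, zero_mul, mul_zero,
          add_zero]
      · subst h; simp; ring
      · have h1 : (-m < 0) := by omega
        have h2 : ¬ (m = 0) := by omega
        have h3 : ¬ (m < 0) := by omega
        simp only [h1, h2, h3, neg_neg, Finsupp.single_eq_same, zpow_neg, ← inv_zpow, if_true,
          if_false]
        norm_num
        ring
    · have h1 : ¬ (m = -n) := fun h' => h (by omega)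
      simp [h, h1]

lemma twoPoint_changeForm :
    (-twoPoint).toQuadraticMap = (0 : QuadraticForm ℂ W) - Q := by
  ext v
  have h := congrArg (fun B : LinearMap.BilinForm ℂ W => B v v) twoPoint_add_flip
  simp only [LinearMap.add_apply, LinearMap.flip_apply] at h
  simp only [LinearMap.BilinMap.toQuadraticMap_apply, Q, sub_apply,
    zero_apply, LinearMap.neg_apply, LinearMap.smul_apply, smul_eq_mul, ← h]
  ring

/-- Wick's normal ordering `Cl(W_B) → Λ W_B`, with contractions given by the two-point function. -/
def normalOrder : Cl →ₗ[ℂ] ExteriorAlgebra ℂ W := CliffordAlgebra.changeForm twoPoint_changeForm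

/-- The vacuum expectation value `⟨0|a|0⟩`: the scalar term of the normal ordering of `a`. -/
def vev : Cl →ₗ[ℂ] ℂ := ExteriorAlgebra.algebraMapInv.toLinearMap ∘ₗ normalOrder

lemma normalOrder_ι_mul (v : W) (x : Cl) :
    normalOrder (CliffordAlgebra.ι Q v * x)
      = ExteriorAlgebra.ι ℂ v * normalOrder x
        + CliffordAlgebra.contractLeft (twoPoint v) (normalOrder x) := by
  rw [normalOrder, CliffordAlgebra.changeForm_ι_mul]
  simp [sub_eq_add_neg]

lemma vev_one : vev 1 = 1 := by
  simp [vev, normalOrder]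

lemma vev_φ_mul_φ (m n : ℤ) :
    vev (φ m * φ n) = if m = -n then (if 0 < n then (-1 : ℂ) ^ m else if n = 0 then 1 / 2 else 0)
      else 0 := by
  have h : vev (φ m * φ n) = twoPoint (Finsupp.single m 1) (Finsupp.single n 1) := by
    have h1 : normalOrder (φ n) = ExteriorAlgebra.ι ℂ (Finsupp.single n 1) := by
      rw [φ, normalOrder, CliffordAlgebra.changeForm_ι]
    rw [vev, LinearMap.comp_apply, φ, normalOrder_ι_mul, h1, CliffordAlgebra.contractLeft_ι]
    simp [ExteriorAlgebra.algebraMapInv]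
  rw [h, twoPoint_single, Finsupp.single_apply]
  by_cases h : m = -n
  · subst h
    rcases lt_trichotomy n 0 with h | h | h
    · have h1 : ¬ (0 < n) := by omega
      have h2 : ¬ (n = 0) := by omega
      simp [h1, h2]
    · subst h; simp
    · simp [h]
  · have h' : ¬ (n = -m) := fun h' => h (by omega)
    simp [h, h']

lemma vev_φ_mul {n : ℤ} (hn : 0 < n) (x : Cl) : vev (φ n * x) = 0 := by
  have h : twoPoint (Finsupp.single n 1) = 0 := by
    ext1 m
    ext
    have h1 : ¬ (n < 0) := by omega
    have h2 : ¬ (n = 0) := by omega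
    simp [twoPoint_single, h1, h2]
  rw [vev, LinearMap.comp_apply, φ, normalOrder_ι_mul, h]
  simp [ExteriorAlgebra.algebraMapInv]

lemma contractLeft_mul_ι {d : Module.Dual ℂ W} {v : W} (hd : d v = 0)
    (x : ExteriorAlgebra ℂ W) :
    CliffordAlgebra.contractLeft d (x * ExteriorAlgebra.ι ℂ v)
      = CliffordAlgebra.contractLeft d x * ExteriorAlgebra.ι ℂ v := by
  induction x using CliffordAlgebra.left_induction with
  | algebraMap r =>
    rw [CliffordAlgebra.contractLeft_algebraMap_mul, CliffordAlgebra.contractLeft_ι, hd]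
    simp
  | add x y hx hy => rw [add_mul, map_add, hx, hy, map_add, add_mul]
  | ι_mul x m hx =>
    rw [mul_assoc, CliffordAlgebra.contractLeft_ι_mul, hx, CliffordAlgebra.contractLeft_ι_mul,
      sub_mul, smul_mul_assoc, mul_assoc]

lemma vev_mul_φ {n : ℤ} (hn : n < 0) (x : Cl) : vev (x * φ n) = 0 := by
  have key : normalOrder (x * φ n)
      = normalOrder x * ExteriorAlgebra.ι ℂ (Finsupp.single n 1) := by
    induction x using CliffordAlgebra.left_induction with
    | algebraMap r =>
      rw [← Algebra.smul_def, map_smul, φ, normalOrder, CliffordAlgebra.changeForm_ι,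
        CliffordAlgebra.changeForm_algebraMap, ← Algebra.smul_def]
    | add x y hx hy => rw [add_mul, map_add, hx, hy, map_add, add_mul]
    | ι_mul x m hx =>
      have h : twoPoint m (Finsupp.single n 1) = 0 := by
        induction m using Finsupp.induction_linear with
        | zero => simp
        | add f g hf hg => rw [map_add, LinearMap.add_apply, hf, hg, add_zero]
        | single k b =>
          rw [twoPoint_single, Finsupp.single_apply]
          by_cases h : n = -k
          · have h1 : ¬ (k < 0) := by omega
            have h2 : ¬ (k = 0) := by omega
            simp only [h1, h2, if_false, zero_mul, mul_zero]
          · simp [h]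
      rw [mul_assoc, normalOrder_ι_mul, hx, contractLeft_mul_ι h, normalOrder_ι_mul, add_mul,
        mul_assoc]
  rw [vev, LinearMap.comp_apply, key]
  simp [ExteriorAlgebra.algebraMapInv]

lemma vev_mul_of_mem_braIdeal {x : Cl} (hx : x ∈ braIdeal) : ∀ b : Cl, vev (x * b) = 0 := by
  rw [braIdeal] at hx
  induction hx using Submodule.span_induction with
  | mem x h => obtain ⟨n, hn, rfl⟩ := h; exact vev_φ_mul hn
  | zero => simp
  | add x y _ _ h1 h2 => intro b; rw [add_mul, map_add, h1, h2, add_zero]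
  | smul a x _ h => intro b; rw [MulOpposite.smul_eq_mul_unop, mul_assoc]; exact h _

lemma vev_mul_of_mem_ketIdeal {x : Cl} (hx : x ∈ ketIdeal) : ∀ a : Cl, vev (a * x) = 0 := by
  rw [ketIdeal] at hx
  induction hx using Submodule.span_induction with
  | mem x h => obtain ⟨n, hn, rfl⟩ := h; exact vev_mul_φ hn
  | zero => simp
  | add x y _ _ h1 h2 => intro b; rw [mul_add, map_add, h1, h2, add_zero]
  | smul a x _ h => intro b; rw [smul_eq_mul, ← mul_assoc]; exact h _

/-- For `b ∈ Cl(W_B)`, the functional `⟨0|a ↦ ⟨0|a b|0⟩` on `F_B^*`. -/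
def braFunctional (b : Cl) : Module.Dual ℂ Bra :=
  (braIdeal.restrictScalars ℂ).liftQ (vev ∘ₗ LinearMap.mulRight ℂ b)
      (fun _ hx => vev_mul_of_mem_braIdeal hx b) ∘ₗ
    (Submodule.Quotient.restrictScalarsEquiv ℂ braIdeal).symm.toLinearMap

/-- The completed right Fock space: the full dual of `F_B^*`. It contains `F_B` through `pairing`;
in terms of the basis `φ_{n_1} ⋯ φ_{n_k}|0⟩` it consists of the arbitrary infinite combinations. -/
abbrev KetHat : Type := Module.Dual ℂ Bra

/-- The pairing of `F_B^*` and `F_B`: `pairing (b|0⟩) (⟨0|a) = ⟨0|a b|0⟩`. -/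
def pairing : Ket →ₗ[ℂ] KetHat :=
  (ketIdeal.restrictScalars ℂ).liftQ
      { toFun := braFunctional
        map_add' := fun b c => by
          refine LinearMap.ext fun U => ?_
          obtain ⟨a, rfl⟩ := Submodule.Quotient.mk_surjective _ U
          show vev (a * (b + c)) = vev (a * b) + vev (a * c)
          rw [mul_add, map_add]
        map_smul' := fun r b => by
          refine LinearMap.ext fun U => ?_
          obtain ⟨a, rfl⟩ := Submodule.Quotient.mk_surjective _ U
          show vev (a * (r • b)) = r • vev (a * b)
          rw [mul_smul_comm, map_smul] }
      (fun b hb => by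
        refine LinearMap.ext fun U => ?_
        obtain ⟨a, rfl⟩ := Submodule.Quotient.mk_surjective _ U
        exact vev_mul_of_mem_ketIdeal hb a) ∘ₗ
    (Submodule.Quotient.restrictScalarsEquiv ℂ ketIdeal).symm.toLinearMap

lemma pairing_mk (a b : Cl) :
    pairing (Submodule.Quotient.mk b) (Submodule.Quotient.mk a) = vev (a * b) := rfl

/-- An operator on the Fock space, possibly an infinite (formal) expression in the fermions such as
the exponential of an infinite quadratic expression: a linear map from `F_B` to its completion. It
is the same as an array of matrix elements `⟨U|G|V⟩` that is bilinear in `U` and `V`. -/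
abbrev Operator : Type := Ket →ₗ[ℂ] KetHat

/-- The matrix element `⟨U|G|V⟩`. -/
def matrixElement (U : Bra) (G : Operator) (V : Ket) : ℂ := G V U

/-- An element of the Clifford algebra as an operator. -/
def Operator.ofCl (g : Cl) : Operator := pairing ∘ₗ Algebra.lsmul ℂ ℂ Ket g

/-! ### Finiteness of the sums -/

lemma exists_pairForm_eq_zero (v : W) : ∃ N : ℤ, ∀ n : ℤ, N < |n| →
    pairForm (Finsupp.single n 1) v = 0 := by
  refine ⟨∑ i ∈ v.support, |i|, fun n hn => ?_⟩
  rw [pairForm_single]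
  by_cases h : v (-n) = 0
  · simp [h]
  · exfalso
    have := Finset.single_le_sum (f := fun i : ℤ => |i|) (fun i _ => abs_nonneg i)
      (Finsupp.mem_support_iff.mpr h)
    simp only [abs_neg] at this
    omega

lemma exists_φ_smul_eq_zero (V : Ket) : ∃ N : ℤ, ∀ n < N, φ n • V = 0 := by
  obtain ⟨x, rfl⟩ := Submodule.Quotient.mk_surjective _ V
  have key : ∃ N : ℤ, ∀ n < N, φ n * x ∈ ketIdeal := by
    induction x using CliffordAlgebra.left_induction with
    | algebraMap r =>
      refine ⟨0, fun n hn => ?_⟩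
      rw [← Algebra.commutes]
      exact ketIdeal.smul_mem (algebraMap ℂ Cl r) (Submodule.subset_span ⟨n, hn, rfl⟩)
    | add x y hx hy =>
      obtain ⟨N, hN⟩ := hx
      obtain ⟨M, hM⟩ := hy
      refine ⟨min N M, fun n hn => ?_⟩
      rw [mul_add]
      exact add_mem (hN n (by omega)) (hM n (by omega))
    | ι_mul x v hx =>
      obtain ⟨N, hN⟩ := hx
      obtain ⟨M, hM⟩ := exists_pairForm_eq_zero v
      refine ⟨min N (-|M|), fun n hn => ?_⟩
      have h0 : pairForm (Finsupp.single n 1) v = 0 := by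
        apply hM
        have := le_abs_self M
        have := neg_abs_le n
        omega
      have h := ι_mul_add_swap (Finsupp.single n 1) v
      rw [h0, map_zero] at h
      rw [← mul_assoc, φ, eq_neg_of_add_eq_zero_left h, neg_mul, mul_assoc]
      exact neg_mem (ketIdeal.smul_mem (CliffordAlgebra.ι Q v) (hN n (by omega)))
  obtain ⟨N, hN⟩ := key
  exact ⟨N, fun n hn => (Submodule.Quotient.mk_eq_zero _).mpr (hN n hn)⟩

lemma exists_bra_φ_eq_zero (U : Bra) : ∃ N : ℤ, ∀ n > N, U <• φ n = 0 := by
  obtain ⟨x, rfl⟩ := Submodule.Quotient.mk_surjective _ U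
  have key : ∃ N : ℤ, ∀ n > N, x * φ n ∈ braIdeal := by
    induction x using CliffordAlgebra.right_induction with
    | algebraMap r =>
      refine ⟨0, fun n hn => ?_⟩
      rw [Algebra.commutes]
      exact braIdeal.smul_mem (MulOpposite.op (algebraMap ℂ Cl r))
        (Submodule.subset_span ⟨n, hn, rfl⟩)
    | add x y hx hy =>
      obtain ⟨N, hN⟩ := hx
      obtain ⟨M, hM⟩ := hy
      refine ⟨max N M, fun n hn => ?_⟩
      rw [add_mul]
      exact add_mem (hN n (by omega)) (hM n (by omega))
    | mul_ι v x hx =>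
      obtain ⟨N, hN⟩ := hx
      obtain ⟨M, hM⟩ := exists_pairForm_eq_zero v
      refine ⟨max N |M|, fun n hn => ?_⟩
      have h0 : pairForm (Finsupp.single n 1) v = 0 := by
        apply hM
        have := le_abs_self M
        have := le_abs_self n
        omega
      have h := ι_mul_add_swap (Finsupp.single n 1) v
      rw [h0, map_zero] at h
      rw [mul_assoc, φ, eq_neg_of_add_eq_zero_right h, mul_neg, ← mul_assoc]
      exact neg_mem (braIdeal.smul_mem (MulOpposite.op (CliffordAlgebra.ι Q v)) (hN n (by omega)))
  obtain ⟨N, hN⟩ := key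
  exact ⟨N, fun n hn => (Submodule.Quotient.mk_eq_zero _).mpr (hN n hn)⟩

/-! ### The basic bilinear identity -/

/-- The basic bilinear identity
`∑_n (-1)^n ⟨U|G φ_n|V⟩ ⟨U'|G φ_{-n}|V'⟩ = ∑_n (-1)^n ⟨U|φ_n G|V⟩ ⟨U'|φ_{-n} G|V'⟩`.
Both sums have finitely many non-zero terms. -/
def BasicBilinearIdentity (G : Operator) : Prop :=
  ∀ (U U' : Bra) (V V' : Ket),
    ∑ᶠ n : ℤ, (-1 : ℂ) ^ n * matrixElement U G (φ n • V) * matrixElement U' G (φ (-n) • V')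
      = ∑ᶠ n : ℤ, (-1 : ℂ) ^ n * matrixElement (U <• φ n) G V * matrixElement (U' <• φ (-n)) G V'

lemma finite_support_ket (G : Operator) (U U' : Bra) (V V' : Ket) :
    (Function.support fun n : ℤ => (-1 : ℂ) ^ n * matrixElement U G (φ n • V) *
      matrixElement U' G (φ (-n) • V')).Finite := by
  obtain ⟨N, hN⟩ := exists_φ_smul_eq_zero V
  obtain ⟨M, hM⟩ := exists_φ_smul_eq_zero V'
  refine (Set.finite_Icc N (-M)).subset fun n hn => ?_
  rw [Function.mem_support] at hn
  by_contra hc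
  apply hn
  rcases lt_or_ge n N with h | h
  · simp [matrixElement, hN n h]
  · have : -n < M := by
      by_contra h'
      exact hc ⟨h, by omega⟩
    simp [matrixElement, hM _ this]

lemma finite_support_bra (G : Operator) (U U' : Bra) (V V' : Ket) :
    (Function.support fun n : ℤ => (-1 : ℂ) ^ n * matrixElement (U <• φ n) G V *
      matrixElement (U' <• φ (-n)) G V').Finite := by
  obtain ⟨N, hN⟩ := exists_bra_φ_eq_zero U
  obtain ⟨M, hM⟩ := exists_bra_φ_eq_zero U'
  refine (Set.finite_Icc (-M) N).subset fun n hn => ?_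
  rw [Function.mem_support] at hn
  by_contra hc
  apply hn
  rcases lt_or_ge N n with h | h
  · simp [matrixElement, hN n h]
  · have : -n > M := by
      by_contra h'
      exact hc ⟨by omega, h⟩
    simp [matrixElement, hM _ this]

/-! ### The Hamiltonians and the current operator `H_+(t)` -/

/-- The right action of `H_n = (1/2) ∑_i (-1)^{i+1} φ_i φ_{-i-n}` on `F_B^*`, for `n ≠ 0`
(the sum is then finite on every vector). -/
def braH (n : ℤ) (U : Bra) : Bra :=
  (1 / 2 : ℂ) • ∑ᶠ i : ℤ, (-1 : ℂ) ^ (i + 1) • (U <• (φ i * φ (-i - n)))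

lemma finite_support_braH {n : ℤ} (hn : n ≠ 0) (U : Bra) :
    (Function.support fun i : ℤ => (-1 : ℂ) ^ (i + 1) • (U <• (φ i * φ (-i - n)))).Finite := by
  obtain ⟨N, hN⟩ := exists_bra_φ_eq_zero U
  refine (Set.finite_Icc (-n - N) N).subset fun i hi => ?_
  rw [Function.mem_support] at hi
  by_contra hc
  apply hi
  rcases lt_or_ge N i with h | h
  · rw [MulOpposite.op_mul, mul_smul, hN i h, smul_zero, smul_zero]
  · have h1 : -i - n > N := by
      by_contra h'
      exact hc ⟨by omega, h⟩
    have h2 := φ_anticomm i (-i - n)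
    rw [if_neg (by omega), map_zero] at h2
    rw [eq_neg_of_add_eq_zero_left h2, MulOpposite.op_neg, neg_smul, MulOpposite.op_mul, mul_smul,
      hN _ h1, smul_zero, neg_zero, smul_zero]

/-- The index set `{1, 3, 5, …}` of the time variables `t = (t_1, t_3, t_5, …)`. -/
abbrev OddIdx : Type := {k : ℕ // Odd k}

/-- Formal power series in `t_1, t_3, …` with coefficients in `F_B^*`; `u α` is the coefficient of
the monomial `t^α`. -/
abbrev BraSeries : Type := (OddIdx →₀ ℕ) → Bra

/-- The right action `u ↦ u H_+(t)` of `H_+(t) = ∑_{k ≥ 1 odd} t_k H_k`. -/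
def braHPlus (u : BraSeries) : BraSeries := fun α =>
  ∑ k ∈ α.support, braH (k.1 : ℤ) (u (α - Finsupp.single k 1))

/-- The right action `u ↦ u e^{H_+(t)} = ∑_N u H_+(t)^N / N!`. Since `u H_+(t)^N` has no terms of
degree less than `N`, only `N ≤ |α|` contribute to the coefficient of `t^α`. -/
def braExpHPlus (u : BraSeries) : BraSeries := fun α =>
  ∑ N ∈ Finset.range (α.degree + 1), (1 / (N.factorial : ℂ)) • (braHPlus^[N] u) α

/-- `⟨0|e^{H_+(t)}`. -/
def vacExp : BraSeries := braExpHPlus (Pi.single 0 vacBra)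

/-! ### Tau functions -/

/-- Formal power series in the times `t`. -/
abbrev TimeSeries : Type := MvPowerSeries OddIdx ℂ

/-- `τ_n(t) = ⟨0|e^{H_+(t)} G|0⟩`. -/
def tau (G : Operator) : TimeSeries := fun α => matrixElement (vacExp α) G vacKet

/-- `τ_{n+1}(t) = 2⟨0|e^{H_+(t)} φ(ζ) G φ_0|0⟩` with `φ(ζ) = ∑_{k ∈ ℤ} φ_k ζ^k`: a formal series
in `ζ`, whose coefficient of `ζ^k` is `tauNext G k = 2⟨0|e^{H_+(t)} φ_k G φ_0|0⟩`. -/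
def tauNext (G : Operator) : ℤ → TimeSeries := fun k α =>
  2 * matrixElement (vacExp α <• φ k) G (φ 0 • vacKet)

/-! ### The bilinear identity

Formal Laurent series in `z⁻¹` are written as `LaurentSeries ℂ`, the variable being `z⁻¹`: the
coefficient of `z^m` is `coeff (-m)`. -/

/-- Formal power series in the two sets of times `t` (left summand) and `t'` (right summand). -/
abbrev TwoTimeSeries (R : Type) : Type := MvPowerSeries (OddIdx ⊕ OddIdx) R

/-- `ξ(t - t', z) = ∑_{k ≥ 1 odd} (t_k - t'_k) z^k`. -/
def xiDiff : TwoTimeSeries (LaurentSeries ℂ) := fun d =>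
  ∑ᶠ k : OddIdx, (HahnSeries.single (-(k.1 : ℤ)) (1 : ℂ)) *
    (MvPowerSeries.coeff d (MvPowerSeries.X (Sum.inl k) - MvPowerSeries.X (Sum.inr k)))

lemma finite_support_xiDiff (d : OddIdx ⊕ OddIdx →₀ ℕ) :
    (Function.support fun k : OddIdx => (HahnSeries.single (-(k.1 : ℤ)) (1 : ℂ)) *
      (MvPowerSeries.coeff d (MvPowerSeries.X (R := LaurentSeries ℂ) (Sum.inl k)
        - MvPowerSeries.X (Sum.inr k)))).Finite := by
  classical
  refine ((d.support.finite_toSet.preimage Sum.inl_injective.injOn).union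
    (d.support.finite_toSet.preimage Sum.inr_injective.injOn)).subset fun k hk => ?_
  rw [Function.mem_support] at hk
  by_contra hc
  simp only [Set.mem_union, Set.mem_preimage, Finset.mem_coe, Finsupp.mem_support_iff, not_or,
    not_not] at hc
  apply hk
  rw [map_sub, MvPowerSeries.coeff_X, MvPowerSeries.coeff_X, if_neg, if_neg, sub_zero, mul_zero]
  · rintro rfl
    simp at hc
  · rintro rfl
    simp at hc

lemma constantCoeff_xiDiff : MvPowerSeries.constantCoeff xiDiff = 0 := by
  classical
  rw [← MvPowerSeries.coeff_zero_eq_constantCoeff_apply]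
  change (∑ᶠ k : OddIdx, _) = _
  refine finsum_eq_zero_of_forall_eq_zero fun k => ?_
  simp

lemma hasSubst_xiDiff : PowerSeries.HasSubst xiDiff :=
  PowerSeries.HasSubst.of_constantCoeff_zero constantCoeff_xiDiff

/-- `e^{ξ(t - t', z)}`. -/
def expXiDiff : TwoTimeSeries (LaurentSeries ℂ) :=
  (PowerSeries.exp ℂ).subst xiDiff

/-- The family `t_k + s (2/k) w^k`, `k` odd, in the power series ring in `t` and an additional
variable `w` (the variable `none`). -/
def shiftedTimes (s : ℂ) (k : OddIdx) : MvPowerSeries (Option OddIdx) ℂ :=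
  MvPowerSeries.X (some k) + MvPowerSeries.C (s * (2 / (k.1 : ℂ))) * MvPowerSeries.X none ^ k.1

lemma hasSubst_shiftedTimes (s : ℂ) : MvPowerSeries.HasSubst (shiftedTimes s) := by
  classical
  refine ⟨fun k => ?_, fun d => ?_⟩
  · have hk : k.1 ≠ 0 := fun h => by simpa [h] using k.2
    simp [shiftedTimes, hk]
  · refine ((d.support.finite_toSet.preimage (Option.some_injective OddIdx).injOn).union
      ((Set.finite_Iic (d none)).preimage Subtype.val_injective.injOn)).subset fun k hk => ?_
    by_contra hc
    simp only [Set.mem_union, Set.mem_preimage, Finset.mem_coe, Finsupp.mem_support_iff, not_or,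
      not_not, Set.mem_Iic, not_le] at hc
    apply hk
    rw [shiftedTimes, map_add, MvPowerSeries.coeff_C_mul, MvPowerSeries.coeff_X,
      MvPowerSeries.coeff_X_pow, if_neg, if_neg, mul_zero, add_zero]
    · rintro rfl
      simp at hc
    · rintro rfl
      simp at hc

/-- `f(t + s[z⁻¹])` where `[w] = (2w, 2w³/3, 2w⁵/5, …)`, as a power series in `t` whose
coefficients are power series in `w = z⁻¹`. -/
def miwaShift (s : ℂ) (f : TimeSeries) : MvPowerSeries OddIdx (PowerSeries ℂ) := fun α =>
  PowerSeries.mk fun m =>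
    MvPowerSeries.coeff (Finsupp.optionElim m α) (f.subst (shiftedTimes s))

/-- `f(t + s[z⁻¹])` among the series in `t, t', z⁻¹`. -/
def shiftLeft (s : ℂ) (f : TimeSeries) : TwoTimeSeries (LaurentSeries ℂ) :=
  MvPowerSeries.map (HahnSeries.ofPowerSeries ℤ ℂ) (MvPowerSeries.rename Function.Embedding.inl (miwaShift s f))

/-- `f(t' + s[z⁻¹])` among the series in `t, t', z⁻¹`. -/
def shiftRight (s : ℂ) (f : TimeSeries) : TwoTimeSeries (LaurentSeries ℂ) :=
  MvPowerSeries.map (HahnSeries.ofPowerSeries ℤ ℂ) (MvPowerSeries.rename Function.Embedding.inr (miwaShift s f))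

/-- The residue `∮_{C_∞} F dz / (2πiz)`: the coefficient of `z^0`. -/
def residue (F : TwoTimeSeries (LaurentSeries ℂ)) : TwoTimeSeries ℂ := fun d =>
  (MvPowerSeries.coeff d F).coeff 0

/-- `f(t)` as a series in `t, t'`. -/
def atLeft (f : TimeSeries) : TwoTimeSeries ℂ := MvPowerSeries.rename Function.Embedding.inl f

/-- `f(t')` as a series in `t, t'`. -/
def atRight (f : TimeSeries) : TwoTimeSeries ℂ := MvPowerSeries.rename Function.Embedding.inr f

end
end BKP

/-!
The residue identity follows from the basic bilinear identity through the boson-fermion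
correspondence. For `ε = ±1` one has
`e^{ε ξ(t,z)} ⟨0|e^{H_+(t - ε[z⁻¹])} = 2 ⟨0|φ_0 e^{H_+(t)} φ(εz)`
(`BKP.coeff_expXi_mul_miwaShift`). Its vacuum case `⟨0|e^{H_+(-[w])} = 2 ⟨0|φ_0 φ(w⁻¹)`
(`BKP.vacMiwa_neg_one`) holds because both sides solve the same Euler equation in `w`, an identity
that involves only the anticommutation relations of `∑_i φ_{-i} w^i`, `∑_i φ_{-i} (-w)^i` and `φ_0`
(`BKP.fermi_euler`). The general case follows by commuting `φ(z)` with `e^{H_+(t)}`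
(`BKP.braφ_hexp`).

With `ε = 1` on the first and `ε = -1` on the second factor, the residue becomes
`8 ∑_n (-1)^n ⟨0|φ_0 e^{H_+(t)} φ_n φ_k G φ_0|0⟩ ⟨0|φ_0 e^{H_+(t')} φ_{-n} G|0⟩`.
Moving `φ_k` to the left of `φ_n` produces one extra term, and in the remaining sum the basic
bilinear identity moves the `φ_n` past `G`, where only `n = 0` survives on the vacua
(`BKP.bilinear_sum_φ`).

It remains to remove the `φ_0` next to the two left vacua. They form the tensor square of the parity
operator on the Fock space, and `G ⊗ G` commutes with that square although `G` need not commute with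
the parity operator itself (`BKP.opForm_parity`). Indeed, for each `N` the truncated
Casimir element `∑_{|n| ≤ N} (-1)^n φ_n ⊗ φ_{-n}`, which `G ⊗ G` intertwines by hypothesis, is a sum of
commuting elements of square `1/4`, the normalized tensor squares of an orthogonal basis. By Newton's
identities their product is a polynomial in their sum (`BKP.prod_mem_adjoin_sum`), and this product
is a multiple of the tensor square of the central element of the Clifford algebra of
`φ_{-N}, …, φ_N`, which acts on the vacua as `φ_0`.
-/

namespace BKP

noncomputable section

open scoped RightActions TensorProduct

/-! ### The Clifford action and the Hamiltonians on the left Fock space -/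

lemma linearMap_finsum {ι M N : Type*} [AddCommMonoid M] [AddCommMonoid N] [Module ℂ M]
    [Module ℂ N] (f : M →ₗ[ℂ] N) {g : ι → M} (hg : (Function.support g).Finite) :
    f (∑ᶠ i, g i) = ∑ᶠ i, f (g i) :=
  f.toAddMonoidHom.map_finsum hg

/-- The right action of `φ_n` on `F_B^*`, as a linear map. -/
def braφ (n : ℤ) : Bra →ₗ[ℂ] Bra := Algebra.lsmul ℂ ℂ Bra (MulOpposite.op (φ n))

lemma braφ_apply (n : ℤ) (U : Bra) : braφ n U = U <• φ n := rfl

lemma mk_act (a b : Cl) :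
    (Submodule.Quotient.mk a : Bra) <• b = Submodule.Quotient.mk (a * b) := rfl

lemma braφ_anticomm (m n : ℤ) (U : Bra) :
    braφ n (braφ m U) + braφ m (braφ n U) = (if m = -n then (-1 : ℂ) ^ m else 0) • U := by
  obtain ⟨a, rfl⟩ := Submodule.Quotient.mk_surjective _ U
  simp only [braφ_apply, mk_act]
  rw [← Submodule.Quotient.mk_add, ← Submodule.Quotient.mk_smul, mul_assoc, mul_assoc, ← mul_add,
    φ_anticomm, ← Algebra.commutes, Algebra.smul_def]

lemma braφ_vacBra {n : ℤ} (hn : 0 < n) : braφ n vacBra = 0 := by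
  rw [braφ_apply, vacBra, mk_act, one_mul, Submodule.Quotient.mk_eq_zero]
  exact Submodule.subset_span ⟨n, hn, rfl⟩

lemma neg_one_zpow_odd_add (k : OddIdx) (i : ℤ) : (-1 : ℂ) ^ (i + (k.1 : ℤ)) = -(-1 : ℂ) ^ i := by
  rw [zpow_add₀ (by norm_num), zpow_natCast, k.2.neg_one_pow]; ring

lemma neg_one_zpow_mul_self (n : ℤ) : (-1 : ℂ) ^ n * (-1 : ℂ) ^ n = 1 := by
  rw [← mul_zpow]; norm_num

lemma oddIdx_pos (k : OddIdx) : 0 < k.1 := k.2.pos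

/-- The right action of `H_k` on `F_B^*` for odd `k > 0`, as a linear map. -/
def ham (k : OddIdx) : Module.End ℂ Bra where
  toFun U := braH k.1 U
  map_add' U V := by
    have hk : (k.1 : ℤ) ≠ 0 := by have := oddIdx_pos k; omega
    simp only [braH, smul_add]
    rw [finsum_add_distrib (finite_support_braH hk U) (finite_support_braH hk V), smul_add]
  map_smul' c U := by
    have hk : (k.1 : ℤ) ≠ 0 := by have := oddIdx_pos k; omega
    simp only [braH, RingHom.id_apply]
    rw [smul_comm c, smul_finsum' c (finite_support_braH hk U)]
    congr 1
    refine finsum_congr fun i => ?_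
    rw [smul_comm c, smul_comm c]

lemma ham_apply (k : OddIdx) (U : Bra) : ham k U = braH k.1 U := rfl

lemma act_φ_mul_φ (i j : ℤ) (U : Bra) : U <• (φ i * φ j) = braφ j (braφ i U) := by
  rw [MulOpposite.op_mul, mul_smul]; rfl

lemma ham_eq (k : OddIdx) (U : Bra) :
    ham k U = (1 / 2 : ℂ) • ∑ᶠ i : ℤ, (-1 : ℂ) ^ (i + 1) • braφ (-i - k.1) (braφ i U) := by
  simp only [ham_apply, braH, act_φ_mul_φ]

lemma finite_support_quadratic {n : ℤ} (hn : n ≠ 0) (U : Bra) :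
    (Function.support fun i : ℤ => (-1 : ℂ) ^ (i + 1) • braφ (-i - n) (braφ i U)).Finite := by
  simpa only [act_φ_mul_φ] using finite_support_braH hn U

/-- The commutation relation `[φ_j, H_k] = -φ_{j-k}`. -/
lemma ham_braφ (k : OddIdx) (j : ℤ) (U : Bra) :
    ham k (braφ j U) = braφ j (ham k U) - braφ (j - k.1) U := by
  have hk : (k.1 : ℤ) ≠ 0 := by have := oddIdx_pos k; omega
  have hterm : ∀ i : ℤ, (-1 : ℂ) ^ (i + 1) • braφ (-i - k.1) (braφ i (braφ j U))
      = braφ j ((-1 : ℂ) ^ (i + 1) • braφ (-i - k.1) (braφ i U))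
        - ((if i = -j then braφ (j - k.1) U else 0)
          + (if i = j - k.1 then braφ (j - k.1) U else 0)) := by
    intro i
    have h1 := braφ_anticomm j i U
    have h2 := braφ_anticomm j (-i - k.1) (braφ i U)
    rw [← eq_sub_iff_add_eq] at h1 h2
    rw [h1, map_sub, map_smul, map_smul, h2]
    have e1 : (if j = -i then (-1 : ℂ) ^ j else 0) • braφ (-i - k.1) U
        = (-1 : ℂ) ^ (i + 1) • -(if i = -j then braφ (j - k.1) U else 0) := by
      by_cases h : i = -j
      · subst h
        rw [if_pos (by omega), if_pos rfl, neg_neg, smul_neg, zpow_add₀ (by norm_num), zpow_neg,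
          ← inv_zpow]
        norm_num
      · rw [if_neg (by omega), if_neg h]; simp
    have e2 : (if j = -(-i - (k.1 : ℤ)) then (-1 : ℂ) ^ j else 0) • braφ i U
        = (-1 : ℂ) ^ (i + 1) • (if i = j - k.1 then braφ (j - k.1) U else 0) := by
      by_cases h : i = j - k.1
      · have hj : j = i + k.1 := by omega
        subst hj
        rw [if_pos (by omega), if_pos (by omega), neg_one_zpow_odd_add, zpow_add₀ (by norm_num)]
        simp
      · rw [if_neg (by omega), if_neg h]; simp
    rw [e1, e2]
    have h3 : (-1 : ℂ) ^ (i + 1) * (-1 : ℂ) ^ (i + 1) = 1 := neg_one_zpow_mul_self _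
    simp only [smul_sub, smul_smul, h3, one_smul]
    abel
  have f1 : (Function.support fun i : ℤ => if i = -j then braφ (j - k.1) U else 0).Finite :=
    (Set.finite_singleton (-j)).subset fun i hi => by
      by_contra h; exact hi (if_neg h)
  have f2 : (Function.support fun i : ℤ => if i = j - k.1 then braφ (j - k.1) U else 0).Finite :=
    (Set.finite_singleton (j - k.1)).subset fun i hi => by
      by_contra h; exact hi (if_neg h)
  have f3 := finite_support_quadratic hk U
  rw [ham_eq, finsum_congr hterm, finsum_sub_distrib, finsum_add_distrib f1 f2, ham_eq]
  · have g1 : ∑ᶠ i : ℤ, (if i = -j then braφ (j - k.1) U else 0) = braφ (j - k.1) U := by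
      rw [finsum_eq_single _ (-j) (fun i hi => if_neg hi), if_pos rfl]
    have g2 : ∑ᶠ i : ℤ, (if i = j - k.1 then braφ (j - k.1) U else 0) = braφ (j - k.1) U := by
      rw [finsum_eq_single _ (j - k.1) (fun i hi => if_neg hi), if_pos rfl]
    rw [g1, g2, map_smul, ← linearMap_finsum (braφ j) f3, smul_sub, ← two_smul ℂ,
      smul_smul]
    norm_num
  · refine f3.subset fun i hi => ?_
    rw [Function.mem_support] at hi ⊢
    intro h
    exact hi (by rw [h, map_zero])
  · exact (f1.union f2).subset (Function.support_add _ _)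

/-- The Hamiltonians commute: moving `H_l` through `H_k` produces two infinite sums that differ
by a shift of the summation index by `l`. -/
lemma ham_comm (k l : OddIdx) (U : Bra) : ham k (ham l U) = ham l (ham k U) := by
  have hk : (k.1 : ℤ) ≠ 0 := by have := oddIdx_pos k; omega
  have hkl : ((k.1 : ℤ) + l.1) ≠ 0 := by have := oddIdx_pos k; omega
  have f1 := finite_support_quadratic hk U
  have f2 := finite_support_quadratic hk (ham l U)
  have f3 := finite_support_quadratic hkl U
  set F : ℤ → Bra := fun i => (-1 : ℂ) ^ (i + 1) • braφ (-i - (k.1 + l.1)) (braφ i U) with hF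
  have hterm : ∀ i : ℤ, ham l ((-1 : ℂ) ^ (i + 1) • braφ (-i - k.1) (braφ i U))
      = (-1 : ℂ) ^ (i + 1) • braφ (-i - k.1) (braφ i (ham l U)) - (F i - F (i - l.1)) := by
    intro i
    have h4 := neg_one_zpow_odd_add l (i - l.1 + 1)
    rw [show i - (l.1 : ℤ) + 1 + l.1 = i + 1 by ring] at h4
    rw [map_smul, ham_braφ, ham_braφ, hF]
    simp only [map_sub, smul_sub]
    rw [show (-(i - (l.1 : ℤ)) - (k.1 + l.1)) = -i - k.1 by ring,
      show (-i - ((k.1 : ℤ) + l.1)) = -i - k.1 - l.1 by ring,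
      show (-1 : ℂ) ^ (i - (l.1 : ℤ) + 1) = -(-1 : ℂ) ^ (i + 1) by rw [h4, neg_neg], neg_smul]
    abel
  have f4 : (Function.support fun i : ℤ => F (i - l.1)).Finite :=
    f3.preimage (sub_left_injective.injOn)
  have hshift : ∑ᶠ i : ℤ, F (i - l.1) = ∑ᶠ i : ℤ, F i :=
    finsum_comp_equiv (Equiv.subRight (l.1 : ℤ)) (f := F)
  have h5 : ham l (ham k U) = (1 / 2 : ℂ) • ∑ᶠ i : ℤ, ham l ((-1 : ℂ) ^ (i + 1) •
      braφ (-i - k.1) (braφ i U)) := by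
    rw [ham_eq k U, map_smul]
    congr 1
    exact linearMap_finsum (ham l) f1
  rw [h5, finsum_congr hterm, finsum_sub_distrib f2, finsum_sub_distrib f3 f4, hshift, sub_self,
    sub_zero, ham_eq k]
  exact (f3.union f4).subset (Function.support_sub _ _)

/-- Left multiplication by `φ_0` preserves the right ideal `(∑_{n>0} ℂ φ_n) Cl`. -/
lemma φ_zero_mul_mem_braIdeal {x : Cl} (hx : x ∈ braIdeal) : φ 0 * x ∈ braIdeal := by
  rw [braIdeal] at hx
  induction hx using Submodule.span_induction with
  | mem x h =>
    obtain ⟨n, hn, rfl⟩ := h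
    have h := φ_anticomm 0 n
    rw [if_neg (by omega), map_zero] at h
    rw [eq_neg_of_add_eq_zero_left h]
    exact neg_mem (braIdeal.smul_mem (MulOpposite.op (φ 0)) (Submodule.subset_span ⟨n, hn, rfl⟩))
  | zero => simp
  | add x y _ _ h1 h2 => rw [mul_add]; exact add_mem h1 h2
  | smul a x _ h =>
    rw [MulOpposite.smul_eq_mul_unop, ← mul_assoc]
    exact braIdeal.smul_mem a h

/-- The operator `⟨0|a ↦ ⟨0|φ_0 a` on `F_B^*`, which commutes with the right action of the
Clifford algebra. -/
def braZero : Bra →ₗ[Clᵐᵒᵖ] Bra :=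
  braIdeal.mapQ braIdeal
    { toFun := fun x => φ 0 * x
      map_add' := fun x y => mul_add _ _ _
      map_smul' := fun a x => by
        simp only [MulOpposite.smul_eq_mul_unop, RingHom.id_apply, mul_assoc] }
    (fun _ hx => φ_zero_mul_mem_braIdeal hx)

lemma braZero_mk (a : Cl) :
    braZero (Submodule.Quotient.mk a) = Submodule.Quotient.mk (φ 0 * a) := rfl

lemma braZero_smul (c : ℂ) (U : Bra) : braZero (c • U) = c • braZero U := by
  obtain ⟨a, rfl⟩ := Submodule.Quotient.mk_surjective _ U
  rw [← Submodule.Quotient.mk_smul, braZero_mk, braZero_mk, mul_smul_comm,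
    Submodule.Quotient.mk_smul]

lemma braZero_braφ (n : ℤ) (U : Bra) : braZero (braφ n U) = braφ n (braZero U) :=
  map_smul braZero (MulOpposite.op (φ n)) U

lemma braZero_ham (k : OddIdx) (U : Bra) : braZero (ham k U) = ham k (braZero U) := by
  have hk : (k.1 : ℤ) ≠ 0 := by have := oddIdx_pos k; omega
  rw [ham_eq, ham_eq, braZero_smul]
  congr 1
  refine (braZero.toAddMonoidHom.map_finsum (finite_support_quadratic hk U)).trans ?_
  refine finsum_congr fun i => ?_
  rw [LinearMap.toAddMonoidHom_coe, braZero_smul, braZero_braφ, braZero_braφ]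

/-! ### Exponentials of the Hamiltonians -/

/-- The commutative algebra of operators on `F_B^*` generated by the Hamiltonians. -/
abbrev HamAlg : Type := Algebra.adjoin ℂ (Set.range ham)

instance : IsMulCommutative HamAlg := Algebra.isMulCommutative_adjoin ℂ (by
  rintro _ ⟨k, rfl⟩ _ ⟨l, rfl⟩
  exact LinearMap.ext fun U => ham_comm k l U)

open scoped IsMulCommutative in
instance : CommRing HamAlg := inferInstance

/-- `H_k` as an element of the commutative algebra of Hamiltonians. -/
def hamC (k : OddIdx) : HamAlg := ⟨ham k, Algebra.subset_adjoin ⟨k, rfl⟩⟩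

/-- `α! = ∏_k α_k!`. -/
def mfact {σ : Type} (α : σ →₀ ℕ) : ℂ := α.prod fun _ n => (n.factorial : ℂ)

lemma mfact_ne_zero {σ : Type} (α : σ →₀ ℕ) : mfact α ≠ 0 :=
  Finset.prod_ne_zero_iff.mpr fun _ _ => Nat.cast_ne_zero.mpr (Nat.factorial_ne_zero _)

@[simp] lemma mfact_zero {σ : Type} : mfact (0 : σ →₀ ℕ) = 1 := Finsupp.prod_zero_index

/-- Passing from `α` to `α + e_k` in a product over the entries of a multi-index that multiplies
the `k`-th factor by `c`. -/
lemma prod_add_single {σ R : Type} [CommMonoid R] (f : σ → ℕ → R) (hf : ∀ k, f k 0 = 1)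
    (α : σ →₀ ℕ) (k : σ) (c : R) (h : f k (α k + 1) = c * f k (α k)) :
    (α + Finsupp.single k 1).prod f = c * α.prod f := by
  classical
  have hs : α.support ⊆ insert k α.support := Finset.subset_insert _ _
  have hs' : (α + Finsupp.single k 1).support ⊆ insert k α.support := by
    intro i hi
    by_cases hik : i = k
    · simp [hik]
    · rw [Finsupp.mem_support_iff, Finsupp.add_apply, Finsupp.single_apply, if_neg (Ne.symm hik),
        add_zero] at hi
      simp [hi]
  rw [Finsupp.prod_of_support_subset _ hs' _ fun i _ => hf i,
    Finsupp.prod_of_support_subset _ hs _ fun i _ => hf i,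
    ← Finset.mul_prod_erase _ _ (Finset.mem_insert_self k _),
    ← Finset.mul_prod_erase _ _ (Finset.mem_insert_self k _), ← mul_assoc]
  congr 1
  · simp [h]
  · refine Finset.prod_congr rfl fun i hi => ?_
    have : i ≠ k := Finset.ne_of_mem_erase hi
    simp [this.symm]

lemma mfact_add_single {σ : Type} (α : σ →₀ ℕ) (k : σ) :
    mfact (α + Finsupp.single k 1) = (α k + 1) * mfact α :=
  prod_add_single _ (by simp) α k _ (by push_cast [Nat.factorial_succ]; ring)

/-- The divided power `H^α / α!`, the coefficient of `t^α` in `e^{H_+(t)}`. -/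
def hamExp (α : OddIdx →₀ ℕ) : HamAlg := (mfact α)⁻¹ • α.prod fun k n => hamC k ^ n

@[simp] lemma hamExp_zero : hamExp 0 = 1 := by simp [hamExp]

lemma hamC_mul_hamExp (k : OddIdx) (α : OddIdx →₀ ℕ) :
    hamC k * hamExp α = ((α k : ℂ) + 1) • hamExp (α + Finsupp.single k 1) := by
  rw [hamExp, hamExp, mfact_add_single, prod_add_single _ (by simp) α k (hamC k) (by ring),
    smul_smul, mul_smul_comm]
  congr 1
  have := mfact_ne_zero α
  have : (α k : ℂ) + 1 ≠ 0 := Nat.cast_add_one_ne_zero _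
  field_simp

/-- The coefficient of `t^α` in `e^{H_+(t)}`, acting on `F_B^*`. -/
def hexp (α : OddIdx →₀ ℕ) : Module.End ℂ Bra := (hamExp α).1

@[simp] lemma hexp_zero (U : Bra) : hexp 0 U = U := by simp [hexp]

lemma ham_hexp (k : OddIdx) (α : OddIdx →₀ ℕ) (U : Bra) :
    ham k (hexp α U) = ((α k : ℂ) + 1) • hexp (α + Finsupp.single k 1) U :=
  congrArg (fun x : HamAlg => x.1 U) (hamC_mul_hamExp k α)

lemma exists_add_single {σ : Type} {α : σ →₀ ℕ} (h : α ≠ 0) :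
    ∃ (β : σ →₀ ℕ) (k : σ), α = β + Finsupp.single k 1 := by
  obtain ⟨k, hk⟩ := Finsupp.ne_iff.mp h
  exact ⟨α - Finsupp.single k 1, k, (tsub_add_cancel_of_le (by
    rw [Finsupp.single_le_iff]; exact Nat.one_le_iff_ne_zero.mpr hk)).symm⟩

/-- Induction on multi-indices: add one unit vector at a time. -/
lemma multiIndex_induction {σ : Type} {p : (σ →₀ ℕ) → Prop} (h0 : p 0)
    (hs : ∀ β k, p β → p (β + Finsupp.single k 1)) (α : σ →₀ ℕ) : p α := by
  induction hn : α.degree generalizing α with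
  | zero => rw [(Finsupp.degree_eq_zero_iff α).mp hn]; exact h0
  | succ n ih =>
    have hα : α ≠ 0 := by rintro rfl; simp at hn
    obtain ⟨β, k, rfl⟩ := exists_add_single hα
    refine hs β k (ih β ?_)
    simpa using hn

lemma braZero_hexp (α : OddIdx →₀ ℕ) (U : Bra) : braZero (hexp α U) = hexp α (braZero U) := by
  induction α using multiIndex_induction with
  | h0 => simp
  | hs β k ih =>
    have hne : (β k : ℂ) + 1 ≠ 0 := Nat.cast_add_one_ne_zero _
    have h1 := ham_hexp k β U
    have h2 := ham_hexp k β (braZero U)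
    rw [← inv_smul_eq_iff₀ hne] at h1 h2
    rw [← h1, ← h2, braZero_smul, braZero_ham, ih]

/-- The power `U H_+(t)^N` is the part of degree `N` of `N! · U e^{H_+(t)}`. -/
lemma iterate_braHPlus (U : Bra) (N : ℕ) (α : OddIdx →₀ ℕ) :
    (braHPlus^[N] (Pi.single 0 U)) α = if α.degree = N then (N.factorial : ℂ) • hexp α U else 0 := by
  induction N generalizing α with
  | zero =>
    by_cases h : α = 0
    · subst h; simp
    · have : α.degree ≠ 0 := fun h' => h ((Finsupp.degree_eq_zero_iff α).mp h')
      simp [h, this]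
  | succ N ih =>
    rw [Function.iterate_succ_apply', braHPlus]
    have hterm : ∀ k ∈ α.support, braH (k.1 : ℤ) ((braHPlus^[N] (Pi.single 0 U))
        (α - Finsupp.single k 1))
        = if α.degree = N + 1 then (N.factorial * α k : ℂ) • hexp α U else 0 := by
      intro k hk
      have hk1 : Finsupp.single k 1 ≤ α := by
        rw [Finsupp.single_le_iff]
        exact Nat.one_le_iff_ne_zero.mpr (Finsupp.mem_support_iff.mp hk)
      obtain ⟨β, rfl⟩ := exists_add_of_le hk1
      rw [add_tsub_cancel_left, ih, ← ham_apply]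
      simp only [map_add, Finsupp.degree_single]
      by_cases h : β.degree = N
      · rw [if_pos h, if_pos (by omega), map_smul, ham_hexp, smul_smul, add_comm β]
        simp [add_comm]
      · rw [if_neg h, if_neg (by omega), map_zero]
    rw [Finset.sum_congr rfl hterm]
    by_cases h : α.degree = N + 1
    · simp only [h, if_true]
      rw [← Finset.sum_smul, ← Finset.mul_sum]
      congr 1
      rw [← Nat.cast_sum]
      have : ∑ i ∈ α.support, α i = N + 1 := h
      rw [this, Nat.factorial_succ]
      push_cast
      ring
    · simp [h]

lemma braExpHPlus_single (U : Bra) (α : OddIdx →₀ ℕ) :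
    braExpHPlus (Pi.single 0 U) α = hexp α U := by
  rw [braExpHPlus, Finset.sum_eq_single α.degree]
  · rw [iterate_braHPlus, if_pos rfl, smul_smul, one_div_mul_cancel
      (Nat.cast_ne_zero.mpr (Nat.factorial_ne_zero _)), one_smul]
  · intro N _ hN
    rw [iterate_braHPlus, if_neg hN.symm, smul_zero]
  · intro h
    exact absurd (Finset.mem_range.mpr (Nat.lt_succ_self _)) h

lemma vacExp_eq (α : OddIdx →₀ ℕ) : vacExp α = hexp α vacBra := braExpHPlus_single _ _

/-- The weight `∑_k k α_k` of a monomial `t^α`. -/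
def wt (α : OddIdx →₀ ℕ) : ℕ := α.sum fun k n => n * k.1

@[simp] lemma wt_zero : wt 0 = 0 := Finsupp.sum_zero_index

lemma wt_add (α β : OddIdx →₀ ℕ) : wt (α + β) = wt α + wt β :=
  Finsupp.sum_add_index' (by simp) (by intros; ring)

@[simp] lemma wt_single (k : OddIdx) (n : ℕ) : wt (Finsupp.single k n) = n * k.1 :=
  Finsupp.sum_single_index (by simp)

/-- In a sum over `β + γ = α + e_k`, the weight `β_k` removes the terms with `β_k = 0`. -/
lemma sum_antidiagonal_fst {σ M : Type} [DecidableEq σ] [AddCommMonoid M] [Module ℂ M]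
    (α : σ →₀ ℕ) (k : σ) (F : (σ →₀ ℕ) → (σ →₀ ℕ) → M) :
    ∑ p ∈ Finset.HasAntidiagonal.antidiagonal (α + Finsupp.single k 1 : σ →₀ ℕ),
        (p.1 k : ℂ) • F p.1 p.2
      = ∑ p ∈ Finset.HasAntidiagonal.antidiagonal α,
        ((p.1 k : ℂ) + 1) • F (p.1 + Finsupp.single k 1) p.2 := by
  symm
  refine Finset.sum_of_injOn (fun p => (p.1 + Finsupp.single k 1, p.2)) ?_ ?_ ?_ ?_
  · rintro ⟨a, b⟩ _ ⟨c, d⟩ _ h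
    simpa using h
  · rintro ⟨a, b⟩ h
    simp only [Finset.mem_coe, Finset.HasAntidiagonal.mem_antidiagonal] at h ⊢
    rw [← h]; abel
  · rintro ⟨a, b⟩ h hn
    simp only [Finset.HasAntidiagonal.mem_antidiagonal] at h
    suffices a k = 0 by simp [this]
    by_contra hak
    apply hn
    have hk1 : Finsupp.single k 1 ≤ a := by
      rw [Finsupp.single_le_iff]; exact Nat.one_le_iff_ne_zero.mpr hak
    obtain ⟨c, rfl⟩ := exists_add_of_le hk1
    refine ⟨(c, b), ?_, by simp [add_comm]⟩
    simp only [Finset.mem_coe, Finset.HasAntidiagonal.mem_antidiagonal]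
    have h' : Finsupp.single k 1 + (c + b) = Finsupp.single k 1 + α := by
      rw [← add_assoc, h, add_comm]
    exact add_left_cancel h'
  · rintro ⟨a, b⟩ _
    simp

lemma sum_antidiagonal_snd {σ M : Type} [DecidableEq σ] [AddCommMonoid M] [Module ℂ M]
    (α : σ →₀ ℕ) (k : σ) (F : (σ →₀ ℕ) → (σ →₀ ℕ) → M) :
    ∑ p ∈ Finset.HasAntidiagonal.antidiagonal (α + Finsupp.single k 1 : σ →₀ ℕ),
        (p.2 k : ℂ) • F p.1 p.2
      = ∑ p ∈ Finset.HasAntidiagonal.antidiagonal α,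
        ((p.2 k : ℂ) + 1) • F p.1 (p.2 + Finsupp.single k 1) := by
  have hswap : ∀ (β : σ →₀ ℕ) (g : (σ →₀ ℕ) × (σ →₀ ℕ) → M),
      ∑ p ∈ Finset.HasAntidiagonal.antidiagonal β, g p.swap
        = ∑ p ∈ Finset.HasAntidiagonal.antidiagonal β, g p := fun β g =>
    Finset.sum_equiv (Equiv.prodComm _ _) (by simp [add_comm]) (by simp)
  rw [← hswap (α + Finsupp.single k 1), ← hswap α]
  exact sum_antidiagonal_fst α k (fun a b => F b a)

/-- `e^{H_+(t)} φ(z) = e^{ξ(t,z)} φ(z) e^{H_+(t)}`, by coefficients. -/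
lemma braφ_hexp (j : ℤ) (α : OddIdx →₀ ℕ) (U : Bra) :
    braφ j (hexp α U) = ∑ p ∈ Finset.HasAntidiagonal.antidiagonal α,
      (mfact p.2)⁻¹ • hexp p.1 (braφ (j - wt p.2) U) := by
  induction α using multiIndex_induction generalizing j with
  | h0 => simp
  | hs α k ih =>
    have hne : (α k : ℂ) + 1 ≠ 0 := Nat.cast_add_one_ne_zero _
    apply smul_right_injective _ hne
    show ((α k : ℂ) + 1) • _ = ((α k : ℂ) + 1) • _
    -- Multiplied by `α_k + 1`, the claim for `α + e_k` is the claim for `α` with `H_k` applied.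
    rw [← map_smul, ← ham_hexp]
    have h1 := ham_braφ k j (hexp α U)
    rw [eq_sub_iff_add_eq] at h1
    rw [← h1, ih j, ih (j - k.1), Finset.smul_sum]
    have hsplit : ∀ p ∈ Finset.HasAntidiagonal.antidiagonal (α + Finsupp.single k 1 : OddIdx →₀ ℕ),
        ((α k : ℂ) + 1) • (mfact p.2)⁻¹ • hexp p.1 (braφ (j - wt p.2) U)
        = (p.1 k : ℂ) • (mfact p.2)⁻¹ • hexp p.1 (braφ (j - wt p.2) U)
          + (p.2 k : ℂ) • (mfact p.2)⁻¹ • hexp p.1 (braφ (j - wt p.2) U) := by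
      intro p hp
      rw [← add_smul]
      congr 1
      have := congrArg (fun a => ((a k : ℕ) : ℂ)) (Finset.HasAntidiagonal.mem_antidiagonal.mp hp)
      simpa using this.symm
    rw [Finset.sum_congr rfl hsplit, Finset.sum_add_distrib,
      sum_antidiagonal_fst α k (fun a b => (mfact b)⁻¹ • hexp a (braφ (j - wt b) U)),
      sum_antidiagonal_snd α k (fun a b => (mfact b)⁻¹ • hexp a (braφ (j - wt b) U)), map_sum]
    congr 1
    · refine Finset.sum_congr rfl fun p _ => ?_
      rw [map_smul, ham_hexp, smul_comm]
    · refine Finset.sum_congr rfl fun p _ => ?_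
      have h2 : (p.2 k : ℂ) + 1 ≠ 0 := Nat.cast_add_one_ne_zero _
      rw [mfact_add_single, smul_smul, mul_inv, mul_inv_cancel_left₀ h2, wt_add, wt_single]
      congr 4
      push_cast
      ring

/-! ### Vacuum vertex operators -/

/-- The odd `k ≤ m`. -/
def oddLe (m : ℕ) : Finset OddIdx :=
  ((Set.finite_Iic m).preimage Subtype.val_injective.injOn : ((fun k : OddIdx => k.1) ⁻¹'
    Set.Iic m).Finite).toFinset

@[simp] lemma mem_oddLe {m : ℕ} {k : OddIdx} : k ∈ oddLe m ↔ k.1 ≤ m := by simp [oddLe]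

lemma mul_le_wt (γ : OddIdx →₀ ℕ) (k : OddIdx) : γ k * k.1 ≤ wt γ := by
  by_cases hk : k ∈ γ.support
  · exact Finset.single_le_sum (f := fun k : OddIdx => γ k * k.1) (fun _ _ => Nat.zero_le _) hk
  · simp [Finsupp.notMem_support_iff.mp hk]

lemma support_subset_oddLe (γ : OddIdx →₀ ℕ) : γ.support ⊆ oddLe (wt γ) := by
  intro k hk
  have h1 : 1 ≤ γ k := Nat.one_le_iff_ne_zero.mpr (Finsupp.mem_support_iff.mp hk)
  rw [mem_oddLe]
  exact (Nat.le_mul_of_pos_left _ h1).trans (mul_le_wt γ k)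

lemma finite_wt_eq (m : ℕ) : {γ : OddIdx →₀ ℕ | wt γ = m}.Finite := by
  classical
  refine ((oddLe m).finsupp fun _ => Finset.range (m + 1)).finite_toSet.subset fun γ hγ => ?_
  replace hγ : wt γ = m := hγ
  subst hγ
  rw [Finset.mem_coe, Finset.mem_finsupp_iff]
  refine ⟨support_subset_oddLe γ, fun k _ => ?_⟩
  have := mul_le_wt γ k
  have := oddIdx_pos k
  rw [Finset.mem_range]
  nlinarith

/-- The multi-indices of weight `m`. -/
def wtEq (m : ℕ) : Finset (OddIdx →₀ ℕ) := (finite_wt_eq m).toFinset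

@[simp] lemma mem_wtEq {m : ℕ} {γ : OddIdx →₀ ℕ} : γ ∈ wtEq m ↔ wt γ = m := by simp [wtEq]

/-- The product `∏_k (s · 2/k)^{γ_k}`: the monomial `t^γ` takes the value
`miwaCoeff s γ * w ^ wt γ` at `t = s[w]`. -/
def miwaCoeff (s : ℂ) (γ : OddIdx →₀ ℕ) : ℂ := γ.prod fun k n => (s * (2 / (k.1 : ℂ))) ^ n

lemma miwaCoeff_add_single (s : ℂ) (γ : OddIdx →₀ ℕ) (k : OddIdx) :
    miwaCoeff s (γ + Finsupp.single k 1) = s * (2 / (k.1 : ℂ)) * miwaCoeff s γ :=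
  prod_add_single _ (by simp) γ k _ (pow_succ' _ _)

/-- The coefficient of `w^m` in `⟨0|e^{H_+(s[w])}`. -/
def vacMiwa (s : ℂ) (m : ℕ) : Bra := ∑ γ ∈ wtEq m, miwaCoeff s γ • hexp γ vacBra

lemma wt_eq_zero {γ : OddIdx →₀ ℕ} (h : wt γ = 0) : γ = 0 := by
  ext k
  have h1 := mul_le_wt γ k
  have h2 := oddIdx_pos k
  rw [h] at h1
  have := Nat.le_zero.mp h1
  rcases Nat.mul_eq_zero.mp this with h3 | h3
  · exact h3
  · omega

lemma vacMiwa_zero (s : ℂ) : vacMiwa s 0 = vacBra := by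
  have h : wtEq 0 = {0} := by
    ext γ
    rw [mem_wtEq, Finset.mem_singleton]
    exact ⟨wt_eq_zero, fun h => by rw [h, wt_zero]⟩
  rw [vacMiwa, h, Finset.sum_singleton, hexp_zero]
  simp [miwaCoeff]

/-- The Euler equation `w ∂_w ⟨0|e^{H_+(s[w])} = 2s ∑_k w^k ⟨0|e^{H_+(s[w])} H_k`. -/
lemma smul_vacMiwa (s : ℂ) (m : ℕ) :
    (m : ℂ) • vacMiwa s m = (2 * s) • ∑ k ∈ oddLe m, ham k (vacMiwa s (m - k.1)) := by
  have h1 : (m : ℂ) • vacMiwa s m = ∑ γ ∈ wtEq m, ∑ k ∈ oddLe m,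
      ((γ k : ℂ) * k.1) • (miwaCoeff s γ • hexp γ vacBra) := by
    rw [vacMiwa, Finset.smul_sum]
    refine Finset.sum_congr rfl fun γ hγ => ?_
    rw [← Finset.sum_smul]
    congr 1
    rw [mem_wtEq] at hγ
    subst hγ
    have : wt γ = ∑ k ∈ oddLe (wt γ), γ k * k.1 :=
      Finset.sum_subset (support_subset_oddLe γ) fun k _ hk => by
        simp [Finsupp.notMem_support_iff.mp hk]
    conv_lhs => rw [this]
    push_cast
    rfl
  rw [h1, Finset.sum_comm, Finset.smul_sum]
  refine Finset.sum_congr rfl fun k hk => ?_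
  rw [mem_oddLe] at hk
  have hk0 : (k.1 : ℂ) ≠ 0 := Nat.cast_ne_zero.mpr (oddIdx_pos k).ne'
  rw [vacMiwa, map_sum, Finset.smul_sum]
  symm
  refine Finset.sum_of_injOn (fun γ => γ + Finsupp.single k 1) (fun a _ b _ h => by simpa using h)
    ?_ ?_ ?_
  · intro γ hγ
    simp only [Finset.mem_coe, mem_wtEq] at hγ ⊢
    rw [wt_add, hγ, wt_single]
    omega
  · intro γ hγ hn
    suffices γ k = 0 by simp [this]
    by_contra h0
    apply hn
    have hk1 : Finsupp.single k 1 ≤ γ := by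
      rw [Finsupp.single_le_iff]; exact Nat.one_le_iff_ne_zero.mpr h0
    obtain ⟨c, rfl⟩ := exists_add_of_le hk1
    refine ⟨c, ?_, by simp [add_comm]⟩
    simp only [Finset.mem_coe, mem_wtEq] at hγ ⊢
    rw [wt_add, wt_single] at hγ
    omega
  · intro γ _
    rw [map_smul, ham_hexp, miwaCoeff_add_single]
    simp only [smul_smul]
    congr 1
    simp
    field_simp

/-! The generating series of the fermions `φ_0, φ_{-1}, φ_{-2}, …`, which do not annihilate the
left vacuum. -/

/-- `∑_{i ≥ 0} φ_{-i} w^i`. -/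
def fermi : PowerSeries Cl := PowerSeries.mk fun i => φ (-(i : ℤ))

/-- `∑_{i ≥ 0} φ_{-i} (-w)^i`. -/
def fermiNeg : PowerSeries Cl := PowerSeries.mk fun i => (-1 : ℂ) ^ i • φ (-(i : ℤ))

lemma coeff_mul_pair (X Y : PowerSeries Cl) (m : ℕ) :
    PowerSeries.coeff m (X * Y) = ∑ p ∈ Finset.HasAntidiagonal.antidiagonal m,
      PowerSeries.coeff p.1 X * PowerSeries.coeff p.2 Y := PowerSeries.coeff_mul _ _ _

lemma coeff_mul_pair_swap (X Y : PowerSeries Cl) (m : ℕ) :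
    PowerSeries.coeff m (X * Y) = ∑ p ∈ Finset.HasAntidiagonal.antidiagonal m,
      PowerSeries.coeff p.2 X * PowerSeries.coeff p.1 Y := by
  rw [PowerSeries.coeff_mul, ← Finset.Nat.sum_antidiagonal_swap]
  rfl

lemma φ_neg_anticomm (i j : ℕ) :
    φ (-(i : ℤ)) * φ (-(j : ℤ)) + φ (-(j : ℤ)) * φ (-(i : ℤ)) = if i = 0 ∧ j = 0 then 1 else 0 := by
  rw [φ_anticomm]
  by_cases h : i = 0 ∧ j = 0
  · obtain ⟨rfl, rfl⟩ := h; simp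
  · rw [if_neg (by omega), if_neg h, map_zero]

lemma sum_antidiagonal_zero_zero (m : ℕ) (F : ℕ → ℕ → Cl) (h0 : F 0 0 = 1)
    (h : ∀ i j, ¬ (i = 0 ∧ j = 0) → F i j = 0) :
    ∑ p ∈ Finset.HasAntidiagonal.antidiagonal m, F p.1 p.2
      = PowerSeries.coeff m (1 : PowerSeries Cl) := by
  rw [PowerSeries.coeff_one]
  by_cases hm : m = 0
  · subst hm; simp [h0]
  · rw [if_neg hm]
    refine Finset.sum_eq_zero fun p hp => h _ _ ?_
    rw [Finset.HasAntidiagonal.mem_antidiagonal] at hp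
    omega

lemma fermi_mul_fermi : fermi * fermi + fermi * fermi = 1 := by
  ext m
  rw [map_add]
  nth_rewrite 1 [coeff_mul_pair]
  rw [coeff_mul_pair_swap, ← Finset.sum_add_distrib]
  refine sum_antidiagonal_zero_zero m (fun i j => PowerSeries.coeff i fermi *
    PowerSeries.coeff j fermi + PowerSeries.coeff j fermi * PowerSeries.coeff i fermi) ?_ ?_
  · simpa [fermi] using φ_neg_anticomm 0 0
  · intro i j h
    simpa [fermi, h] using φ_neg_anticomm i j

lemma fermi_mul_fermiNeg : fermi * fermiNeg + fermiNeg * fermi = 1 := by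
  ext m
  rw [map_add, coeff_mul_pair, coeff_mul_pair_swap fermiNeg, ← Finset.sum_add_distrib]
  refine sum_antidiagonal_zero_zero m (fun i j => PowerSeries.coeff i fermi *
    PowerSeries.coeff j fermiNeg + PowerSeries.coeff j fermiNeg * PowerSeries.coeff i fermi) ?_ ?_
  · simpa [fermi, fermiNeg] using φ_neg_anticomm 0 0
  · intro i j h
    simp only [fermi, fermiNeg, PowerSeries.coeff_mk, mul_smul_comm, smul_mul_assoc]
    rw [← smul_add, φ_neg_anticomm, if_neg h, smul_zero]

lemma fermi_anticomm_φ_zero :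
    fermi * PowerSeries.C (φ 0) + PowerSeries.C (φ 0) * fermi = 1 := by
  ext m
  rw [map_add, PowerSeries.coeff_mul_C, PowerSeries.coeff_C_mul, fermi, PowerSeries.coeff_mk,
    PowerSeries.coeff_one]
  simpa using φ_neg_anticomm m 0

lemma fermiNeg_anticomm_φ_zero :
    fermiNeg * PowerSeries.C (φ 0) + PowerSeries.C (φ 0) * fermiNeg = 1 := by
  ext m
  rw [map_add, PowerSeries.coeff_mul_C, PowerSeries.coeff_C_mul, fermiNeg, PowerSeries.coeff_mk,
    PowerSeries.coeff_one, smul_mul_assoc, mul_smul_comm, ← smul_add]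
  have h := φ_neg_anticomm m 0
  simp only [Nat.cast_zero, neg_zero, and_true] at h
  rw [h]
  by_cases hm : m = 0
  · subst hm; simp
  · simp [hm]

/-- The series identity behind the Euler equation of `⟨0|φ_0 φ(w⁻¹)`, in any ring. -/
lemma fermi_euler {R : Type*} [Ring R] {z A B : R} (h1 : A * A + A * A = 1)
    (h2 : A * B + B * A = 1) (h3 : A * z + z * A = 1) (h4 : B * z + z * B = 1) :
    (2 * (A * B) - 1) * (z * A) - 2 * ((A - B) * A) - z * (A - B) = 0 := by
  have e1 : A * B * z * A = A * A - B * A + z * A * A * 0 + z * (A * B * A) := by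
    have : A * B * z * A = A * (B * z) * A := by noncomm_ring
    rw [this, eq_sub_of_add_eq h4]
    have : A * (1 - z * B) * A = A * A - (A * z) * (B * A) := by noncomm_ring
    rw [this, eq_sub_of_add_eq h3]
    noncomm_ring
  have e2 : A * B * A = A - A * A * B := by
    have : A * B * A = A * (B * A) := by noncomm_ring
    rw [this, eq_sub_of_add_eq' h2]
    noncomm_ring
  have e3 : A * A * B + A * A * B = B := by rw [← add_mul, h1, one_mul]
  have e4 : (2 * (A * B) - 1) * (z * A) - 2 * ((A - B) * A) - z * (A - B)
      = 2 * (A * B * z * A) - 2 * (A * A) + 2 * (B * A) - 2 * (z * A) + z * B := by noncomm_ring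
  rw [e4, e1, e2]
  have e5 : z * (A * A * B) + z * (A * A * B) = z * B := by rw [← mul_add, e3]
  rw [← e5]
  noncomm_ring

lemma sum_oddLe {M : Type*} [AddCommMonoid M] (m : ℕ) (F : ℕ → ℕ → M) :
    ∑ k ∈ oddLe m, F k.1 (m - k.1)
      = ∑ p ∈ Finset.HasAntidiagonal.antidiagonal m, if Odd p.1 then F p.1 p.2 else 0 := by
  refine Finset.sum_of_injOn (fun k => (k.1, m - k.1)) ?_ ?_ ?_ ?_
  · intro a _ b _ h
    exact Subtype.ext (congrArg Prod.fst h)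
  · intro k hk
    simp only [Finset.mem_coe, mem_oddLe, Finset.HasAntidiagonal.mem_antidiagonal] at hk ⊢
    omega
  · rintro ⟨a, b⟩ h hn
    rw [Finset.HasAntidiagonal.mem_antidiagonal] at h
    refine if_neg fun ha => hn ⟨⟨a, ha⟩, ?_, ?_⟩
    · simp only [Finset.mem_coe, mem_oddLe]; omega
    · simp only [Prod.mk.injEq, true_and]; omega
  · intro k _
    exact (if_pos k.2).symm

lemma card_oddLe (m : ℕ) : ((oddLe m).card : ℂ) * 4 = 2 * m + (1 - (-1) ^ m) := by
  have h : (oddLe m).card = (m + 1) / 2 := by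
    rw [Finset.card_eq_sum_ones, sum_oddLe m (fun _ _ => 1),
      Finset.Nat.sum_antidiagonal_eq_sum_range_succ (fun i _ => if Odd i then 1 else 0) m]
    induction m with
    | zero => simp
    | succ m ih =>
      rw [Finset.sum_range_succ, ih]
      rcases Nat.even_or_odd m with h | h
      · rw [if_pos h.add_one]; obtain ⟨r, rfl⟩ := h; omega
      · rw [if_neg (by simpa using h.add_one)]; obtain ⟨r, rfl⟩ := h; omega
  rw [h]
  rcases Nat.even_or_odd m with h | h
  · rw [h.neg_one_pow]
    obtain ⟨r, rfl⟩ := h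
    rw [show (r + r + 1) / 2 = r by omega]
    push_cast; ring
  · rw [h.neg_one_pow]
    obtain ⟨r, rfl⟩ := h
    rw [show (2 * r + 1 + 1) / 2 = r + 1 by omega]
    push_cast; ring

/-- `4 ∑_k ⟨0|H_k w^k = ⟨0|(2 φ(w⁻¹) φ(-w⁻¹) - 1)` in odd degrees. -/
lemma ham_vacBra (k : OddIdx) : (4 : ℂ) • ham k vacBra
    = Submodule.Quotient.mk (PowerSeries.coeff k.1 (2 * (fermi * fermiNeg) - 1)) := by
  have hk := oddIdx_pos k
  have h1 : PowerSeries.coeff k.1 (2 * (fermi * fermiNeg) - 1)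
      = (2 : ℂ) • ∑ p ∈ Finset.HasAntidiagonal.antidiagonal k.1,
        (-1 : ℂ) ^ p.2 • (φ (-(p.1 : ℤ)) * φ (-(p.2 : ℤ))) := by
    rw [map_sub, PowerSeries.coeff_one, if_neg hk.ne', sub_zero, two_mul, map_add, ← two_smul ℂ,
      PowerSeries.coeff_mul]
    simp [fermi, fermiNeg]
  rw [h1, Submodule.Quotient.mk_smul, ham_eq, smul_smul]
  norm_num
  rw [Finset.Nat.sum_antidiagonal_eq_sum_range_succ
    (fun i j => (-1 : ℂ) ^ j • (φ (-(i : ℤ)) * φ (-(j : ℤ)))) k.1]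
  have hsum : (Submodule.Quotient.mk (∑ i ∈ Finset.range k.1.succ, (-1 : ℂ) ^ (k.1 - i) •
      (φ (-(i : ℤ)) * φ (-((k.1 - i : ℕ) : ℤ)))) : Bra)
      = ∑ i ∈ Finset.range k.1.succ, (-1 : ℂ) ^ (k.1 - i) •
        (Submodule.Quotient.mk (φ (-(i : ℤ)) * φ (-((k.1 - i : ℕ) : ℤ))) : Bra) := by
    rw [← Submodule.mkQ_apply, map_sum]
    rfl
  rw [hsum]
  have hsupp : (Function.support fun i : ℤ => (-1 : ℂ) ^ (i + 1) •
      braφ (-i - k.1) (braφ i vacBra)) ⊆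
        ((Finset.range k.1.succ).image fun i : ℕ => -(i : ℤ) : Finset ℤ) := by
    intro i hi
    rw [Function.mem_support] at hi
    by_contra hc
    apply hi
    rcases lt_or_ge 0 i with h | h
    · rw [braφ_vacBra h, map_zero, smul_zero]
    · have h2 : 0 < -i - (k.1 : ℤ) := by
        by_contra h3
        apply hc
        simp only [Finset.coe_image, Set.mem_image, Finset.mem_coe, Finset.mem_range]
        exact ⟨(-i).toNat, by omega, by omega⟩
      have h4 := braφ_anticomm i (-i - k.1) vacBra
      rw [if_neg (by omega), zero_smul, braφ_vacBra h2, map_zero, add_zero] at h4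
      rw [h4, smul_zero]
  rw [finsum_eq_sum_of_support_subset _ hsupp, Finset.sum_image (fun a _ b _ h => by simpa using h)]
  refine Finset.sum_congr rfl fun i hi => ?_
  rw [Finset.mem_range] at hi
  have hi' : i ≤ k.1 := by omega
  rw [vacBra, braφ_apply, braφ_apply, mk_act, mk_act, one_mul]
  congr 1
  · obtain ⟨j, hj⟩ := Nat.exists_eq_add_of_le hi'
    have h5 := k.2
    rw [hj, Nat.add_sub_cancel_left]
    rw [hj, Nat.odd_add] at h5
    rw [zpow_add₀ (by norm_num), zpow_neg, ← inv_zpow, zpow_natCast]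
    norm_num
    rcases Nat.even_or_odd i with h | h
    · rw [h.neg_one_pow, Odd.neg_one_pow]
      by_contra h6
      rw [Nat.not_odd_iff_even] at h6
      exact (Nat.not_odd_iff_even.mpr h) (h5.mpr h6)
    · rw [h.neg_one_pow, (h5.mp h).neg_one_pow]; norm_num
  · congr 3
    omega

lemma coeff_two_mul_fermi_mul_fermiNeg_sub_one_of_even {i : ℕ} (hi : ¬ Odd i) :
    PowerSeries.coeff i (2 * (fermi * fermiNeg) - 1) = 0 := by
  have h : PowerSeries.coeff i (fermi * fermiNeg) = PowerSeries.coeff i (fermiNeg * fermi) := by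
    rw [PowerSeries.coeff_mul, PowerSeries.coeff_mul]
    refine Finset.sum_congr rfl fun p hp => ?_
    rw [Finset.HasAntidiagonal.mem_antidiagonal] at hp
    simp only [fermi, fermiNeg, PowerSeries.coeff_mk, mul_smul_comm, smul_mul_assoc]
    congr 1
    rw [Nat.not_odd_iff_even, ← hp, Nat.even_add] at hi
    rcases Nat.even_or_odd p.1 with h | h
    · rw [h.neg_one_pow, (hi.mp h).neg_one_pow]
    · rw [h.neg_one_pow, Odd.neg_one_pow]
      rw [← Nat.not_even_iff_odd] at h ⊢
      exact fun h' => h (hi.mpr h')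
  rw [map_sub, two_mul, map_add]
  nth_rewrite 2 [h]
  rw [← map_add, fermi_mul_fermiNeg, sub_self]

lemma mk_sum {ι : Type*} (s : Finset ι) (f : ι → Cl) :
    (Submodule.Quotient.mk (∑ i ∈ s, f i) : Bra) = ∑ i ∈ s, Submodule.Quotient.mk (f i) := by
  rw [← Submodule.mkQ_apply, map_sum]
  rfl

/-- The vacuum form of the boson-fermion correspondence:
`⟨0|e^{H_+(-[w])} = 2⟨0|φ_0 φ(w⁻¹)`. Both sides satisfy the Euler equation `smul_vacMiwa`, which
determines the coefficient of `w^m` from those of lower degree. -/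
lemma vacMiwa_neg_one (m : ℕ) :
    vacMiwa (-1) m = (2 : ℂ) • braφ (-(m : ℤ)) (braZero vacBra) := by
  have hz : braZero vacBra = braφ 0 vacBra := by
    rw [vacBra, braZero_mk, braφ_apply, mk_act, one_mul, mul_one]
  rw [hz]
  induction m using Nat.strong_induction_on with
  | _ m ih =>
    rcases Nat.eq_zero_or_pos m with rfl | hm
    · have h := braφ_anticomm 0 0 vacBra
      rw [← two_smul ℂ] at h
      rw [vacMiwa_zero]
      simpa using h.symm
    have hm' : (m : ℂ) ≠ 0 := Nat.cast_ne_zero.mpr hm.ne'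
    apply smul_right_injective _ hm'
    show (m : ℂ) • _ = (m : ℂ) • _
    rw [smul_vacMiwa]
    have hterm : ∀ k ∈ oddLe m, ham k (vacMiwa (-1) (m - k.1))
        = (2 : ℂ) • (Submodule.Quotient.mk (((1 / 4 : ℂ) • (PowerSeries.coeff k.1
            (2 * (fermi * fermiNeg) - 1) * PowerSeries.coeff (m - k.1)
              (PowerSeries.C (φ 0) * fermi)))
            - PowerSeries.coeff k.1 fermi * PowerSeries.coeff (m - k.1) fermi
            - φ 0 * φ (-(m : ℤ))) : Bra) := by
      intro k hk
      rw [mem_oddLe] at hk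
      have := oddIdx_pos k
      rw [ih _ (by omega), map_smul, ham_braφ, ham_braφ]
      congr 1
      have h4 : ham k vacBra = Submodule.Quotient.mk ((1 / 4 : ℂ) •
          PowerSeries.coeff k.1 (2 * (fermi * fermiNeg) - 1)) := by
        rw [Submodule.Quotient.mk_smul, ← ham_vacBra, smul_smul]
        norm_num
      rw [h4, vacBra, map_sub]
      simp only [braφ_apply, mk_act, ← Submodule.Quotient.mk_sub, one_mul]
      rw [PowerSeries.coeff_C_mul, fermi, PowerSeries.coeff_mk, PowerSeries.coeff_mk,
        smul_mul_assoc, smul_mul_assoc, zero_sub, mul_assoc]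
      congr 4
      omega
    rw [Finset.sum_congr rfl hterm, ← Finset.smul_sum, ← mk_sum, Finset.sum_sub_distrib,
      Finset.sum_sub_distrib, ← Finset.smul_sum, sum_oddLe m (fun i j => PowerSeries.coeff i
            (2 * (fermi * fermiNeg) - 1) * PowerSeries.coeff j (PowerSeries.C (φ 0) * fermi)),
      sum_oddLe m (fun i j => PowerSeries.coeff i fermi * PowerSeries.coeff j fermi),
      Finset.sum_const]
    have s1 : ∑ p ∈ Finset.HasAntidiagonal.antidiagonal m, (if Odd p.1 then PowerSeries.coeff p.1
          (2 * (fermi * fermiNeg) - 1) * PowerSeries.coeff p.2 (PowerSeries.C (φ 0) * fermi) else 0)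
        = PowerSeries.coeff m ((2 * (fermi * fermiNeg) - 1) * (PowerSeries.C (φ 0) * fermi)) := by
      rw [PowerSeries.coeff_mul _ (2 * (fermi * fermiNeg) - 1)]
      refine Finset.sum_congr rfl fun p _ => ?_
      by_cases h : Odd p.1
      · rw [if_pos h]
      · rw [if_neg h, coeff_two_mul_fermi_mul_fermiNeg_sub_one_of_even h, zero_mul]
    have s2 : ∑ p ∈ Finset.HasAntidiagonal.antidiagonal m, (if Odd p.1 then PowerSeries.coeff p.1
          fermi * PowerSeries.coeff p.2 fermi else 0)
        = (1 / 2 : ℂ) • PowerSeries.coeff m ((fermi - fermiNeg) * fermi) := by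
      rw [PowerSeries.coeff_mul, Finset.smul_sum]
      refine Finset.sum_congr rfl fun p _ => ?_
      rw [map_sub, ← smul_mul_assoc]
      by_cases h : Odd p.1
      · rw [if_pos h]
        simp only [fermi, fermiNeg, PowerSeries.coeff_mk, h.neg_one_pow]
        congr 1
        module
      · rw [if_neg h]
        rw [Nat.not_odd_iff_even] at h
        simp only [fermi, fermiNeg, PowerSeries.coeff_mk, h.neg_one_pow]
        simp
    have s3 : PowerSeries.coeff m (PowerSeries.C (φ 0) * (fermi - fermiNeg))
        = (1 - (-1 : ℂ) ^ m) • (φ 0 * φ (-(m : ℤ))) := by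
      rw [PowerSeries.coeff_C_mul, map_sub]
      simp only [fermi, fermiNeg, PowerSeries.coeff_mk]
      rw [mul_sub, mul_smul_comm]
      module
    -- The term `φ_0 φ_{-m}` occurs once for each odd `k ≤ m`; counting them gives the derivative
    -- and an odd part, which is what the series identity absorbs.
    have hE := congrArg (PowerSeries.coeff m) (fermi_euler fermi_mul_fermi fermi_mul_fermiNeg
      fermi_anticomm_φ_zero fermiNeg_anticomm_φ_zero)
    rw [map_sub, map_sub, map_zero, s3, two_mul ((fermi - fermiNeg) * fermi), map_add,
      sub_eq_zero, sub_eq_iff_eq_add] at hE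
    rw [s1, s2, hE]
    have hc : ((oddLe m).card : ℂ) = (2 * m + (1 - (-1) ^ m)) / 4 := by
      rw [← card_oddLe]; ring
    rw [vacBra, braφ_apply, braφ_apply, mk_act, mk_act, one_mul, ← Nat.cast_smul_eq_nsmul ℂ, hc]
    simp only [← Submodule.Quotient.mk_smul]
    congr 1
    module

lemma miwaCoeff_one (γ : OddIdx →₀ ℕ) : miwaCoeff 1 γ = (-1) ^ wt γ * miwaCoeff (-1) γ := by
  induction γ using multiIndex_induction with
  | h0 => simp [miwaCoeff]
  | hs γ k ih =>
    rw [miwaCoeff_add_single, miwaCoeff_add_single, ih, wt_add, wt_single, one_mul, one_mul, pow_add,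
      k.2.neg_one_pow]
    ring

lemma vacMiwa_one (m : ℕ) : vacMiwa 1 m = (-1 : ℂ) ^ m • vacMiwa (-1) m := by
  rw [vacMiwa, vacMiwa, Finset.smul_sum]
  refine Finset.sum_congr rfl fun γ hγ => ?_
  rw [miwaCoeff_one, mem_wtEq.mp hγ, smul_smul]

/-! ### The parity operator in the tensor square -/

/-- By Newton's identities, the product of commuting elements `x_i` with `x_i² = 1/4` is a
polynomial in their sum: the odd power sums are multiples of the sum and the even ones are
scalars. -/
lemma prod_mem_adjoin_sum {R ι : Type*} [CommRing R] [Algebra ℂ R] (s : Finset ι) (x : ι → R)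
    (hx : ∀ i ∈ s, x i * x i = algebraMap ℂ R (1 / 4)) :
    ∏ i ∈ s, x i ∈ Algebra.adjoin ℂ {∑ i ∈ s, x i} := by
  classical
  set S := Algebra.adjoin ℂ {∑ i ∈ s, x i} with hS
  let y : s → R := fun i => x i
  have hpow : ∀ (n : ℕ) (i : s), y i ^ (2 * n) = algebraMap ℂ R ((1 / 4) ^ n) := by
    intro n i
    rw [pow_mul, pow_two, hx i i.2, map_pow]
  have hpsum : ∀ n, MvPolynomial.aeval y (MvPolynomial.psum s ℂ n) ∈ S := by
    intro n
    rw [MvPolynomial.psum, map_sum]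
    simp only [map_pow, MvPolynomial.aeval_X]
    rcases Nat.even_or_odd' n with ⟨r, rfl | rfl⟩
    · exact sum_mem fun i _ => by rw [hpow]; exact S.algebraMap_mem _
    · simp only [pow_succ, hpow]
      rw [← Finset.mul_sum]
      refine mul_mem (S.algebraMap_mem _) ?_
      have : ∑ i : s, y i = ∑ i ∈ s, x i := Finset.sum_coe_sort s x
      rw [this]
      exact Algebra.subset_adjoin rfl
  -- Newton's identities express `n • esymm n` through lower elementary symmetric sums.
  have hesymm : ∀ n, MvPolynomial.aeval y (MvPolynomial.esymm s ℂ n) ∈ S := by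
    intro n
    induction n using Nat.strong_induction_on with
    | _ n ih =>
      rcases Nat.eq_zero_or_pos n with rfl | hn
      · simp
      have h := congrArg (MvPolynomial.aeval y) (MvPolynomial.mul_esymm_eq_sum s ℂ n)
      have hn' : (n : ℂ) ≠ 0 := Nat.cast_ne_zero.mpr hn.ne'
      have h2 : MvPolynomial.aeval y (MvPolynomial.esymm s ℂ n)
          = (n : ℂ)⁻¹ • MvPolynomial.aeval y ((n : MvPolynomial s ℂ) * MvPolynomial.esymm s ℂ n) := by
        rw [map_mul, map_natCast, ← nsmul_eq_mul, ← Nat.cast_smul_eq_nsmul ℂ,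
          inv_smul_smul₀ hn']
      rw [h2, h]
      refine S.smul_mem ?_ _
      rw [map_mul, map_sum]
      refine mul_mem ?_ (sum_mem fun a ha => ?_)
      · rw [map_pow, map_neg, map_one]
        exact pow_mem (neg_mem (one_mem _)) _
      · rw [map_mul, map_mul, map_pow, map_neg, map_one]
        refine mul_mem (mul_mem (pow_mem (neg_mem (one_mem _)) _) (ih _ ?_)) (hpsum _)
        exact (Finset.mem_filter.mp ha).2
  have h := hesymm s.card
  have h3 : MvPolynomial.aeval y (MvPolynomial.esymm s ℂ s.card) = ∏ i ∈ s, x i := by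
    rw [MvPolynomial.esymm, ← Fintype.card_coe s, ← Finset.card_univ, Finset.powersetCard_self]
    simp only [Finset.sum_singleton, map_prod, MvPolynomial.aeval_X]
    exact Finset.prod_coe_sort s x
  rwa [h3] at h

/-- An orthogonal basis of the span of the fermions: `φ_j + sgn(j) (-1)^j φ_{-j}`. -/
def orth (j : ℤ) : Cl := φ j + ((j.sign : ℂ) * (-1 : ℂ) ^ j) • φ (-j)

lemma orth_anticomm {i j : ℤ} (h : i ≠ j) : orth i * orth j = -(orth j * orth i) := by
  rw [eq_neg_iff_add_eq_zero]
  have h1 := φ_anticomm i j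
  have h2 := φ_anticomm i (-j)
  have h3 := φ_anticomm (-i) j
  have h4 := φ_anticomm (-i) (-j)
  have e : orth i * orth j + orth j * orth i = (φ i * φ j + φ j * φ i)
      + ((j.sign : ℂ) * (-1 : ℂ) ^ j) • (φ i * φ (-j) + φ (-j) * φ i)
      + ((i.sign : ℂ) * (-1 : ℂ) ^ i) • (φ (-i) * φ j + φ j * φ (-i))
      + (((i.sign : ℂ) * (-1 : ℂ) ^ i) * ((j.sign : ℂ) * (-1 : ℂ) ^ j)) •
        (φ (-i) * φ (-j) + φ (-j) * φ (-i)) := by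
    simp only [orth, add_mul, mul_add, smul_mul_assoc, mul_smul_comm, smul_add, smul_smul]
    rw [mul_comm ((j.sign : ℂ) * (-1 : ℂ) ^ j) ((i.sign : ℂ) * (-1 : ℂ) ^ i)]
    abel
  rw [e, h1, h2, h3, h4, if_neg (show ¬ i = - -j by omega), if_neg (show ¬ -i = -j by omega)]
  by_cases hij : i = -j
  · subst hij
    have hj : j ≠ 0 := by omega
    have hs : (j.sign : ℂ) * j.sign = 1 := by
      rcases lt_or_gt_of_ne hj with h | h
      · simp [Int.sign_eq_neg_one_of_neg h]
      · simp [Int.sign_eq_one_of_pos h]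
    have hp : (-1 : ℂ) ^ (-j) = (-1 : ℂ) ^ j := by rw [zpow_neg, ← inv_zpow]; norm_num
    have hp2 := neg_one_zpow_mul_self j
    simp only [neg_neg, if_true, map_zero, smul_zero, add_zero, hp, Int.sign_neg, Int.cast_neg]
    rw [Algebra.smul_def, ← map_mul, ← map_add]
    rw [show (-1 : ℂ) ^ j + -(j.sign : ℂ) * (-1) ^ j * ((j.sign : ℂ) * (-1) ^ j) * (-1) ^ j
      = (-1) ^ j - ((j.sign : ℂ) * j.sign) * ((-1) ^ j * (-1) ^ j) * (-1) ^ j by ring, hs, hp2]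
    simp
  · rw [if_neg hij, if_neg (by omega)]
    simp

/-- The factor that normalizes `orth j ⊗ orth j` to have square `1/4`. -/
def orthScale (j : ℤ) : ℂ := if j = 0 then 1 else j.sign / 2

lemma orth_sq (j : ℤ) : orth j * orth j = algebraMap ℂ Cl (if j = 0 then 1 / 2 else j.sign) := by
  have h0 : ∀ i : ℤ, φ i * φ i = algebraMap ℂ Cl (if i = 0 then 1 / 2 else 0) := by
    intro i
    have h := φ_anticomm i i
    rw [← two_smul ℂ] at h
    have h' : φ i * φ i = (1 / 2 : ℂ) • ((2 : ℂ) • (φ i * φ i)) := by rw [smul_smul]; norm_num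
    rw [h', h, Algebra.smul_def, ← map_mul]
    congr 1
    by_cases hi : i = 0
    · subst hi; simp
    · rw [if_neg (by omega), if_neg hi, mul_zero]
  have h2 := φ_anticomm j (-j)
  have e : orth j * orth j = φ j * φ j + ((j.sign : ℂ) * (-1 : ℂ) ^ j) •
      (φ j * φ (-j) + φ (-j) * φ j) + (((j.sign : ℂ) * (-1 : ℂ) ^ j) * ((j.sign : ℂ) * (-1 : ℂ) ^ j))
        • (φ (-j) * φ (-j)) := by
    simp only [orth, add_mul, mul_add, smul_mul_assoc, mul_smul_comm, smul_add, smul_smul]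
    abel
  rw [e, h2, h0, h0, neg_neg, if_pos rfl, Algebra.smul_def, Algebra.smul_def, ← map_mul, ← map_mul,
    ← map_add, ← map_add]
  congr 1
  by_cases hj : j = 0
  · subst hj; simp
  · rw [if_neg hj, if_neg (by omega), if_neg hj, mul_assoc, neg_one_zpow_mul_self]
    ring

/-- The normalized tensor squares of the orthogonal basis. -/
def orthSq (j : ℤ) : Cl ⊗[ℂ] Cl := orthScale j • (orth j ⊗ₜ orth j)

lemma orthSq_comm (i j : ℤ) : orthSq i * orthSq j = orthSq j * orthSq i := by
  by_cases h : i = j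
  · rw [h]
  · simp only [orthSq, smul_mul_assoc, mul_smul_comm, Algebra.TensorProduct.tmul_mul_tmul]
    rw [orth_anticomm h, TensorProduct.neg_tmul, TensorProduct.tmul_neg, neg_neg, smul_comm]

lemma orthSq_sq (j : ℤ) : orthSq j * orthSq j = algebraMap ℂ (Cl ⊗[ℂ] Cl) (1 / 4) := by
  simp only [orthSq, smul_mul_assoc, mul_smul_comm, Algebra.TensorProduct.tmul_mul_tmul]
  rw [orth_sq, Algebra.algebraMap_eq_smul_one (A := Cl), TensorProduct.smul_tmul_smul,
    Algebra.algebraMap_eq_smul_one, smul_smul, smul_smul, Algebra.TensorProduct.one_def]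
  congr 1
  unfold orthScale
  by_cases hj : j = 0
  · subst hj; norm_num
  · rw [if_neg hj, if_neg hj]
    have hs : (j.sign : ℂ) * j.sign = 1 := by
      rcases lt_or_gt_of_ne hj with h | h
      · simp [Int.sign_eq_neg_one_of_neg h]
      · simp [Int.sign_eq_one_of_pos h]
    linear_combination (1 / 4 : ℂ) * ((j.sign : ℂ) * j.sign + 1) * hs

/-- The truncated Casimir element `∑_{|n| ≤ N} (-1)^n φ_n ⊗ φ_{-n}`. -/
def casimir (N : ℕ) : Cl ⊗[ℂ] Cl :=
  ∑ n ∈ Finset.Icc (-(N : ℤ)) N, (-1 : ℂ) ^ n • (φ n ⊗ₜ[ℂ] φ (-n))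

/-- Extending a symmetric interval of integers by its two new end points. -/
lemma Icc_neg_succ (N : ℕ) : Finset.Icc (-((N + 1 : ℕ) : ℤ)) ((N + 1 : ℕ) : ℤ)
    = insert (-((N : ℤ) + 1)) (insert ((N : ℤ) + 1) (Finset.Icc (-(N : ℤ)) N)) := by
  ext i
  simp only [Finset.mem_Icc, Finset.mem_insert]
  push_cast
  omega

@[to_additive]
lemma prod_Icc_neg_succ {M : Type*} [CommMonoid M] (N : ℕ) (f : ℤ → M) :
    ∏ i ∈ Finset.Icc (-((N + 1 : ℕ) : ℤ)) ((N + 1 : ℕ) : ℤ), f i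
      = f (-((N : ℤ) + 1)) * (f ((N : ℤ) + 1) * ∏ i ∈ Finset.Icc (-(N : ℤ)) N, f i) := by
  rw [Icc_neg_succ, Finset.prod_insert, Finset.prod_insert]
  · simp
  · simp only [Finset.mem_insert, Finset.mem_Icc]; omega

lemma orthSq_pair {n : ℤ} (hn : 0 < n) : orthSq (-n) + orthSq n
    = (-1 : ℂ) ^ (-n) • (φ (-n) ⊗ₜ[ℂ] φ n) + (-1 : ℂ) ^ n • (φ n ⊗ₜ[ℂ] φ (-n)) := by
  have hp : (-1 : ℂ) ^ (-n) = (-1 : ℂ) ^ n := by rw [zpow_neg, ← inv_zpow]; norm_num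
  have hp2 := neg_one_zpow_mul_self n
  have h1 : ¬ (n = 0) := by omega
  simp only [orthSq, orth, orthScale, neg_eq_zero, if_neg h1, Int.sign_neg,
    Int.sign_eq_one_of_pos hn, hp, neg_neg, TensorProduct.add_tmul, TensorProduct.tmul_add,
    TensorProduct.smul_tmul', TensorProduct.tmul_smul]
  push_cast
  simp only [smul_smul, smul_add, ← TensorProduct.smul_tmul']
  generalize (-1 : ℂ) ^ n = s at hp2
  match_scalars <;> first | ring1 | linear_combination (1 / 2 : ℂ) * hp2 |
    linear_combination (-1 / 2 : ℂ) * hp2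

lemma sum_orthSq (N : ℕ) : ∑ j ∈ Finset.Icc (-(N : ℤ)) N, orthSq j = casimir N := by
  unfold casimir
  induction N with
  | zero => simp [orthSq, orth, orthScale]
  | succ N ih =>
    rw [sum_Icc_neg_succ, sum_Icc_neg_succ, ih, ← add_assoc, ← add_assoc,
      orthSq_pair (by omega), neg_neg]

/-- `1 - 2 (-1)^n φ_n φ_{-n}`: it fixes both vacua, and anticommutes with `φ_{±n}`. -/
def pairSign (n : ℤ) : Cl := 1 - (2 * (-1 : ℂ) ^ n) • (φ n * φ (-n))

/-- The truncated parity element `∏_{1 ≤ n ≤ N} (1 - 2 (-1)^n φ_n φ_{-n})`. -/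
def parity : ℕ → Cl
  | 0 => 1
  | N + 1 => pairSign ((N : ℤ) + 1) * parity N

lemma φ_sq {n : ℤ} (hn : n ≠ 0) : φ n * φ n = 0 := by
  have h := φ_anticomm n n
  rw [← two_smul ℂ, if_neg (by omega), map_zero] at h
  exact (smul_eq_zero.mp h).resolve_left two_ne_zero

lemma φ_anticomm_neg (n : ℤ) : φ (-n) * φ n = algebraMap ℂ Cl ((-1 : ℂ) ^ n) - φ n * φ (-n) := by
  have h := φ_anticomm n (-n)
  rw [if_pos (by omega)] at h
  rw [← h]; abel

lemma φ_anticomm_of_ne {m n : ℤ} (h : m ≠ -n) : φ m * φ n = -(φ n * φ m) := by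
  rw [eq_neg_iff_add_eq_zero, φ_anticomm, if_neg h, map_zero]

lemma pairSign_φ_of_ne {n j : ℤ} (h1 : j ≠ n) (h2 : j ≠ -n) :
    φ j * pairSign n = pairSign n * φ j := by
  have e1 := φ_anticomm_of_ne (m := j) (n := n) h2
  have e2 := φ_anticomm_of_ne (m := j) (n := -n) (by omega)
  have : φ j * (φ n * φ (-n)) = φ n * φ (-n) * φ j := by
    rw [← mul_assoc, e1, neg_mul, mul_assoc, e2, mul_neg, neg_neg, mul_assoc]
  rw [pairSign, mul_sub, sub_mul, mul_smul_comm, smul_mul_assoc, this, mul_one, one_mul]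

lemma pairSign_φ {n : ℤ} (hn : n ≠ 0) : φ n * pairSign n = -(pairSign n * φ n) := by
  have h1 : φ n * (φ n * φ (-n)) = 0 := by rw [← mul_assoc, φ_sq hn, zero_mul]
  have h2 : φ n * φ (-n) * φ n = (-1 : ℂ) ^ n • φ n := by
    rw [mul_assoc, φ_anticomm_neg, mul_sub, h1, sub_zero, ← Algebra.commutes, Algebra.smul_def]
  have h3 := neg_one_zpow_mul_self n
  rw [pairSign, mul_sub, sub_mul, mul_smul_comm, smul_mul_assoc, h1, h2, smul_smul, mul_assoc, h3, mul_one,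
    mul_one, one_mul, smul_zero]
  module

lemma pairSign_φ_neg {n : ℤ} (hn : n ≠ 0) : φ (-n) * pairSign n = -(pairSign n * φ (-n)) := by
  have h1 : φ n * φ (-n) * φ (-n) = 0 := by rw [mul_assoc, φ_sq (by omega), mul_zero]
  have h2 : φ (-n) * (φ n * φ (-n)) = (-1 : ℂ) ^ n • φ (-n) := by
    rw [← mul_assoc, φ_anticomm_neg, sub_mul, h1, sub_zero, Algebra.smul_def]
  have h3 := neg_one_zpow_mul_self n
  rw [pairSign, mul_sub, sub_mul, mul_smul_comm, smul_mul_assoc, h1, h2, smul_smul, mul_assoc, h3, mul_one,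
    mul_one, one_mul, smul_zero]
  module

lemma parity_φ_of_lt {N : ℕ} {j : ℤ} (h : j = 0 ∨ (N : ℤ) < |j|) :
    φ j * parity N = parity N * φ j := by
  induction N with
  | zero => simp [parity]
  | succ N ih =>
    have h1 : j = 0 ∨ (N : ℤ) < |j| := by push_cast at h; omega
    have h2 : j ≠ (N : ℤ) + 1 := by
      rintro rfl; rw [abs_of_pos (by omega)] at h; push_cast at h; omega
    have h3 : j ≠ -((N : ℤ) + 1) := by
      rintro rfl; rw [abs_neg, abs_of_pos (by omega)] at h; push_cast at h; omega
    rw [parity, ← mul_assoc, pairSign_φ_of_ne h2 h3, mul_assoc, ih h1, mul_assoc]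

lemma parity_φ {N : ℕ} {j : ℤ} (h0 : j ≠ 0) (h : |j| ≤ N) :
    φ j * parity N = -(parity N * φ j) := by
  induction N with
  | zero => exact absurd (abs_eq_zero.mp (le_antisymm h (abs_nonneg j))) h0
  | succ N ih =>
    rw [parity, ← mul_assoc]
    rcases lt_or_eq_of_le h with h1 | h1
    · have h4 : |j| ≤ N := by push_cast at h1; omega
      have h2 : j ≠ (N : ℤ) + 1 := by
        rintro rfl; rw [abs_of_pos (by omega)] at h4; omega
      have h3 : j ≠ -((N : ℤ) + 1) := by
        rintro rfl; rw [abs_neg, abs_of_pos (by omega)] at h4; omega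
      rw [pairSign_φ_of_ne h2 h3, mul_assoc, ih h4, mul_neg, mul_assoc]
    · have h4 : (N : ℤ) < |j| := by push_cast at h1; omega
      have h5 : φ j * pairSign ((N : ℤ) + 1) = -(pairSign ((N : ℤ) + 1) * φ j) := by
        rcases abs_choice j with h6 | h6
        · have : j = (N : ℤ) + 1 := by push_cast at h1; omega
          subst this
          exact pairSign_φ h0
        · have : j = -((N : ℤ) + 1) := by push_cast at h1; omega
          subst this
          exact pairSign_φ_neg (by omega)
      rw [h5, neg_mul, mul_assoc, parity_φ_of_lt (Or.inr h4), mul_assoc]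

/-- The Clifford algebra of `φ_{-N}, …, φ_N`. -/
def clTrunc (N : ℕ) : Subalgebra ℂ Cl := Algebra.adjoin ℂ {x | ∃ n : ℤ, |n| ≤ N ∧ x = φ n}

lemma φ_mem_clTrunc {N : ℕ} {n : ℤ} (h : |n| ≤ N) : φ n ∈ clTrunc N :=
  Algebra.subset_adjoin ⟨n, h, rfl⟩

lemma clTrunc_mono {M N : ℕ} (h : M ≤ N) : clTrunc M ≤ clTrunc N :=
  Algebra.adjoin_mono fun _ ⟨n, hn, hx⟩ => ⟨n, by omega, hx⟩

/-- The central element of `clTrunc N`: `φ_0` times the truncated parity. -/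
def central (N : ℕ) : Cl := φ 0 * parity N

lemma central_comm {N : ℕ} {a : Cl} (ha : a ∈ clTrunc N) : a * central N = central N * a := by
  refine (Algebra.commute_of_mem_adjoin_of_forall_mem_commute ha ?_ :
    Commute (central N) a).symm
  rintro _ ⟨n, hn, rfl⟩
  show φ 0 * parity N * φ n = φ n * (φ 0 * parity N)
  by_cases h0 : n = 0
  · subst h0
    rw [mul_assoc, ← parity_φ_of_lt (Or.inl rfl)]
  · have h2 := parity_φ h0 hn
    rw [← mul_assoc, φ_anticomm_of_ne (by omega : n ≠ -0), neg_mul, mul_assoc, mul_assoc, h2,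
      mul_neg, neg_neg]

lemma parity_sub_one_mem_braIdeal (N : ℕ) : parity N - 1 ∈ braIdeal := by
  induction N with
  | zero => simp [parity]
  | succ N ih =>
    have e : parity (N + 1) - 1 = (parity N - 1)
        + φ ((N : ℤ) + 1) * (-((2 * (-1 : ℂ) ^ ((N : ℤ) + 1)) • (φ (-((N : ℤ) + 1)) * parity N))) := by
      rw [parity, pairSign, sub_mul, one_mul, mul_neg, mul_smul_comm, smul_mul_assoc, mul_assoc]
      abel
    rw [e]
    exact add_mem ih (braIdeal.smul_mem (MulOpposite.op _)
      (Submodule.subset_span ⟨(N : ℤ) + 1, by omega, rfl⟩))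

lemma parity_sub_one_mem_ketIdeal (N : ℕ) : parity N - 1 ∈ ketIdeal := by
  induction N with
  | zero => simp [parity]
  | succ N ih =>
    have e : parity (N + 1) - 1 = pairSign ((N : ℤ) + 1) • (parity N - 1)
        + (-((2 * (-1 : ℂ) ^ ((N : ℤ) + 1)) • φ ((N : ℤ) + 1))) • φ (-((N : ℤ) + 1)) := by
      rw [parity, smul_eq_mul, smul_eq_mul, mul_sub, mul_one, neg_mul, smul_mul_assoc]
      nth_rewrite 3 [pairSign]
      abel
    rw [e]
    exact add_mem (ketIdeal.smul_mem _ ih) (ketIdeal.smul_mem _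
      (Submodule.subset_span ⟨-((N : ℤ) + 1), by omega, rfl⟩))

lemma mk_central_mul (N : ℕ) (a : Cl) :
    (Submodule.Quotient.mk (central N * a) : Bra) = Submodule.Quotient.mk (φ 0 * a) := by
  rw [Submodule.Quotient.eq, central, parity_φ_of_lt (Or.inl rfl), ← sub_mul]
  have e : parity N * φ 0 - φ 0 = (parity N - 1) * φ 0 := by noncomm_ring
  rw [e, mul_assoc]
  exact braIdeal.smul_mem (MulOpposite.op (φ 0 * a)) (parity_sub_one_mem_braIdeal N)

lemma mk_mul_central (N : ℕ) (b : Cl) :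
    (Submodule.Quotient.mk (b * central N) : Ket) = Submodule.Quotient.mk (b * φ 0) := by
  rw [Submodule.Quotient.eq, central, ← mul_sub]
  have e : b * (φ 0 * parity N - φ 0) = (b * φ 0) • (parity N - 1) := by
    rw [smul_eq_mul]; noncomm_ring
  rw [e]
  exact ketIdeal.smul_mem _ (parity_sub_one_mem_ketIdeal N)

lemma orth_neg_mul_orth {n : ℤ} (hn : 0 < n) :
    orth (-n) * orth n = (-1 : ℂ) ^ n • pairSign n := by
  have hp : (-1 : ℂ) ^ (-n) = (-1 : ℂ) ^ n := by rw [zpow_neg, ← inv_zpow]; norm_num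
  have hp2 := neg_one_zpow_mul_self n
  have e1 := φ_sq (n := n) (by omega)
  have e2 := φ_sq (n := -n) (by omega)
  have e3 := φ_anticomm_neg n
  rw [Algebra.algebraMap_eq_smul_one] at e3
  simp only [orth, pairSign, Int.sign_neg, Int.sign_eq_one_of_pos hn, hp, neg_neg, mul_add, add_mul,
    smul_mul_assoc, mul_smul_comm, e1, e2, e3]
  push_cast
  generalize (-1 : ℂ) ^ n = s at hp2
  match_scalars <;> first | ring1 | linear_combination hp2

lemma orthSq_neg_mul_orthSq {n : ℤ} (hn : 0 < n) :
    orthSq (-n) * orthSq n = (-1 / 4 : ℂ) • (pairSign n ⊗ₜ[ℂ] pairSign n) := by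
  have h1 : ¬ (n = 0) := by omega
  simp only [orthSq, smul_mul_assoc, mul_smul_comm, Algebra.TensorProduct.tmul_mul_tmul]
  rw [orth_neg_mul_orth hn, TensorProduct.smul_tmul_smul, neg_one_zpow_mul_self, one_smul,
    smul_smul]
  congr 1
  simp only [orthScale, neg_eq_zero, if_neg h1, Int.sign_neg, Int.sign_eq_one_of_pos hn]
  push_cast
  norm_num

/-- The commutative algebra generated by the normalized tensor squares. -/
abbrev OrthAlg : Type := Algebra.adjoin ℂ (Set.range orthSq)

instance : IsMulCommutative OrthAlg := Algebra.isMulCommutative_adjoin ℂ (by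
  rintro _ ⟨i, rfl⟩ _ ⟨j, rfl⟩
  exact orthSq_comm i j)

open scoped IsMulCommutative in
instance : CommRing OrthAlg := inferInstance

/-- `orthSq j` as an element of the commutative algebra that these elements generate. -/
def orthC (j : ℤ) : OrthAlg := ⟨orthSq j, Algebra.subset_adjoin ⟨j, rfl⟩⟩

lemma exists_prod_orthC (N : ℕ) : ∃ c : ℂ, c ≠ 0 ∧
    (∏ j ∈ Finset.Icc (-(N : ℤ)) N, orthC j).1 = c • (central N ⊗ₜ[ℂ] central N) := by
  induction N with
  | zero =>
    refine ⟨1, one_ne_zero, ?_⟩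
    simp [orthC, orthSq, orth, orthScale, central, parity]
  | succ N ih =>
    obtain ⟨c, hc, h⟩ := ih
    refine ⟨-1 / 4 * c, mul_ne_zero (by norm_num) hc, ?_⟩
    have e : central (N + 1) = pairSign ((N : ℤ) + 1) * central N := by
      rw [central, central, parity, ← mul_assoc, ← mul_assoc,
        pairSign_φ_of_ne (by omega) (by omega)]
    rw [prod_Icc_neg_succ, ← mul_assoc, e]
    show (orthSq _ * orthSq _) * (∏ j ∈ Finset.Icc (-(N : ℤ)) N, orthC j).1 = _
    rw [h, orthSq_neg_mul_orthSq (by omega), smul_mul_smul_comm,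
      Algebra.TensorProduct.tmul_mul_tmul]

/-- The tensor square of the central element is a polynomial in the truncated Casimir element. -/
lemma central_tmul_mem (N : ℕ) :
    central N ⊗ₜ[ℂ] central N ∈ Algebra.adjoin ℂ {casimir N} := by
  obtain ⟨c, hc, h⟩ := exists_prod_orthC N
  have h1 := prod_mem_adjoin_sum (Finset.Icc (-(N : ℤ)) N) orthC
    (fun i _ => Subtype.ext (orthSq_sq i))
  have h2 : (∏ j ∈ Finset.Icc (-(N : ℤ)) N, orthC j).1 ∈ Algebra.adjoin ℂ {casimir N} := by
    have h3 : (Algebra.adjoin ℂ (Set.range orthSq)).val (∏ j ∈ Finset.Icc (-(N : ℤ)) N, orthC j)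
        ∈ (Algebra.adjoin ℂ {∑ j ∈ Finset.Icc (-(N : ℤ)) N, orthC j}).map
          (Algebra.adjoin ℂ (Set.range orthSq)).val := Subalgebra.mem_map.mpr ⟨_, h1, rfl⟩
    rw [AlgHom.map_adjoin, Set.image_singleton, map_sum] at h3
    rw [← sum_orthSq]
    exact h3
  rw [h] at h2
  rw [← inv_smul_smul₀ hc (central N ⊗ₜ[ℂ] central N)]
  exact Subalgebra.smul_mem _ h2 _

/-! ### The basic bilinear identity and the parity operator -/

/-- The bilinear form `(a, b) ↦ ⟨0|a G b|0⟩` on the Clifford algebra. -/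
def opForm (G : Operator) : LinearMap.BilinForm ℂ Cl :=
  LinearMap.mk₂ ℂ (fun a b => matrixElement (Submodule.Quotient.mk a) G (Submodule.Quotient.mk b))
    (fun a a' b => map_add (G (Submodule.Quotient.mk b)) (Submodule.Quotient.mk a)
      (Submodule.Quotient.mk a'))
    (fun c a b => map_smul (G (Submodule.Quotient.mk b)) c (Submodule.Quotient.mk a))
    (fun a b b' => congrArg (fun F : KetHat => F (Submodule.Quotient.mk a))
      (map_add G (Submodule.Quotient.mk b) (Submodule.Quotient.mk b')))
    (fun c a b => congrArg (fun F : KetHat => F (Submodule.Quotient.mk a))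
      (map_smul G c (Submodule.Quotient.mk b)))

lemma opForm_apply (G : Operator) (a b : Cl) : opForm G a b
    = matrixElement (Submodule.Quotient.mk a) G (Submodule.Quotient.mk b) := rfl

lemma exists_mul_φ {N : ℕ} {a : Cl} (ha : a ∈ clTrunc N) {n : ℤ} (hn : (N : ℤ) < |n|) :
    ∃ a', a * φ n = φ n * a' := by
  induction ha using Algebra.adjoin_induction with
  | mem x hx =>
    obtain ⟨j, hj, rfl⟩ := hx
    refine ⟨-φ j, ?_⟩
    rw [mul_neg, φ_anticomm_of_ne]
    rintro rfl
    rw [abs_neg] at hj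
    omega
  | algebraMap r => exact ⟨_, Algebra.commutes r _⟩
  | add x y _ _ hx hy =>
    obtain ⟨a, ha⟩ := hx
    obtain ⟨b, hb⟩ := hy
    exact ⟨a + b, by rw [add_mul, ha, hb, mul_add]⟩
  | mul x y _ _ hx hy =>
    obtain ⟨a, ha⟩ := hx
    obtain ⟨b, hb⟩ := hy
    exact ⟨a * b, by rw [mul_assoc, hb, ← mul_assoc, ha, mul_assoc]⟩

lemma exists_φ_mul {N : ℕ} {a : Cl} (ha : a ∈ clTrunc N) {n : ℤ} (hn : (N : ℤ) < |n|) :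
    ∃ a', φ n * a = a' * φ n := by
  induction ha using Algebra.adjoin_induction with
  | mem x hx =>
    obtain ⟨j, hj, rfl⟩ := hx
    refine ⟨-φ j, ?_⟩
    rw [neg_mul, φ_anticomm_of_ne]
    rintro rfl
    rw [abs_neg] at hn
    omega
  | algebraMap r => exact ⟨_, (Algebra.commutes r _).symm⟩
  | add x y _ _ hx hy =>
    obtain ⟨a, ha⟩ := hx
    obtain ⟨b, hb⟩ := hy
    exact ⟨a + b, by rw [mul_add, ha, hb, add_mul]⟩
  | mul x y _ _ hx hy =>
    obtain ⟨a, ha⟩ := hx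
    obtain ⟨b, hb⟩ := hy
    exact ⟨a * b, by rw [← mul_assoc, ha, mul_assoc, hb, ← mul_assoc]⟩

lemma mk_mul_φ_eq_zero {N : ℕ} {a : Cl} (ha : a ∈ clTrunc N) {n : ℤ} (hn : (N : ℤ) < n) :
    (Submodule.Quotient.mk (a * φ n) : Bra) = 0 := by
  obtain ⟨a', h⟩ := exists_mul_φ ha (hn.trans_le (le_abs_self n))
  rw [h, Submodule.Quotient.mk_eq_zero]
  exact braIdeal.smul_mem (MulOpposite.op a') (Submodule.subset_span ⟨n, by omega, rfl⟩)

lemma mk_φ_mul_eq_zero {N : ℕ} {b : Cl} (hb : b ∈ clTrunc N) {n : ℤ} (hn : n < -(N : ℤ)) :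
    (Submodule.Quotient.mk (φ n * b) : Ket) = 0 := by
  obtain ⟨b', h⟩ := exists_φ_mul hb (n := n) (by have := neg_le_abs n; omega)
  rw [h, Submodule.Quotient.mk_eq_zero]
  exact ketIdeal.smul_mem b' (Submodule.subset_span ⟨n, by omega, rfl⟩)

/-- The basic bilinear identity for vectors in the truncated Fock spaces. -/
lemma basicBilinear_trunc {G : Operator} (hG : BasicBilinearIdentity G) {N : ℕ} {a a' b b' : Cl}
    (ha : a ∈ clTrunc N) (ha' : a' ∈ clTrunc N) (hb : b ∈ clTrunc N) (hb' : b' ∈ clTrunc N) :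
    ∑ n ∈ Finset.Icc (-(N : ℤ)) N, (-1 : ℂ) ^ n * opForm G (a * φ n) b * opForm G (a' * φ (-n)) b'
      = ∑ n ∈ Finset.Icc (-(N : ℤ)) N,
        (-1 : ℂ) ^ n * opForm G a (φ n * b) * opForm G a' (φ (-n) * b') := by
  have h := hG (Submodule.Quotient.mk a) (Submodule.Quotient.mk a') (Submodule.Quotient.mk b)
    (Submodule.Quotient.mk b')
  rw [finsum_eq_sum_of_support_subset (s := Finset.Icc (-(N : ℤ)) N),
    finsum_eq_sum_of_support_subset (s := Finset.Icc (-(N : ℤ)) N)] at h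
  · exact h.symm
  · intro n hn
    rw [Function.mem_support] at hn
    by_contra hc
    apply hn
    rw [Finset.coe_Icc, Set.mem_Icc, not_and_or, not_le, not_le] at hc
    rcases hc with hc | hc
    · have : (Submodule.Quotient.mk a' : Bra) <• φ (-n) = 0 := mk_mul_φ_eq_zero ha' (by omega)
      rw [this]; simp [matrixElement]
    · have : (Submodule.Quotient.mk a : Bra) <• φ n = 0 := mk_mul_φ_eq_zero ha hc
      rw [this]; simp [matrixElement]
  · intro n hn
    rw [Function.mem_support] at hn
    by_contra hc
    apply hn
    rw [Finset.coe_Icc, Set.mem_Icc, not_and_or, not_le, not_le] at hc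
    rcases hc with hc | hc
    · have : φ n • (Submodule.Quotient.mk b : Ket) = 0 := mk_φ_mul_eq_zero hb hc
      rw [this]; simp [matrixElement]
    · have : φ (-n) • (Submodule.Quotient.mk b' : Ket) = 0 := mk_φ_mul_eq_zero hb' (by omega)
      rw [this]; simp [matrixElement]

/-- The tensor square of `clTrunc N`, inside the tensor square of the Clifford algebra. -/
def clTruncSq (N : ℕ) : Subalgebra ℂ (Cl ⊗[ℂ] Cl) :=
  (Algebra.TensorProduct.map (clTrunc N).val (clTrunc N).val).range

lemma tmul_mem_clTruncSq {N : ℕ} {a b : Cl} (ha : a ∈ clTrunc N) (hb : b ∈ clTrunc N) :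
    a ⊗ₜ[ℂ] b ∈ clTruncSq N := ⟨(⟨a, ha⟩ : clTrunc N) ⊗ₜ[ℂ] (⟨b, hb⟩ : clTrunc N), rfl⟩

lemma clTruncSq_induction {N : ℕ} {p : Cl ⊗[ℂ] Cl → Prop} (h0 : p 0)
    (ht : ∀ a ∈ clTrunc N, ∀ b ∈ clTrunc N, p (a ⊗ₜ b)) (hadd : ∀ x y, p x → p y → p (x + y))
    {x : Cl ⊗[ℂ] Cl} (hx : x ∈ clTruncSq N) : p x := by
  obtain ⟨y, rfl⟩ := hx
  induction y using TensorProduct.induction_on with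
  | zero => simpa using h0
  | tmul a b => exact ht a a.2 b b.2
  | add y z hy hz =>
    have := hadd _ _ hy hz
    rwa [← map_add] at this

/-- The form `opForm G` on the tensor square. -/
def opFormSq (G : Operator) : LinearMap.BilinForm ℂ (Cl ⊗[ℂ] Cl) :=
  LinearMap.BilinForm.tmul (opForm G) (opForm G)

lemma opFormSq_tmul (G : Operator) (a a' b b' : Cl) :
    opFormSq G (a ⊗ₜ a') (b ⊗ₜ b') = opForm G a b * opForm G a' b' := by
  simp [opFormSq, mul_comm]

lemma casimir_mem (N : ℕ) : casimir N ∈ clTruncSq N := by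
  refine sum_mem fun n hn => Subalgebra.smul_mem _ (tmul_mem_clTruncSq (φ_mem_clTrunc ?_)
    (φ_mem_clTrunc ?_)) _
  · rw [Finset.mem_Icc] at hn
    exact abs_le.mpr hn
  · rw [Finset.mem_Icc] at hn
    rw [abs_neg]
    exact abs_le.mpr hn

lemma opFormSq_casimir {G : Operator} (hG : BasicBilinearIdentity G) {N : ℕ} {A B : Cl ⊗[ℂ] Cl}
    (hA : A ∈ clTruncSq N) (hB : B ∈ clTruncSq N) :
    opFormSq G (A * casimir N) B = opFormSq G A (casimir N * B) := by
  refine clTruncSq_induction (p := fun A => opFormSq G (A * casimir N) B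
    = opFormSq G A (casimir N * B)) (by simp) ?_ ?_ hA
  · intro a ha a' ha'
    refine clTruncSq_induction (p := fun B => opFormSq G (a ⊗ₜ a' * casimir N) B
      = opFormSq G (a ⊗ₜ a') (casimir N * B)) (by simp) ?_ ?_ hB
    · intro b hb b' hb'
      have h := basicBilinear_trunc hG ha ha' hb hb'
      simp only [casimir, Finset.mul_sum, Finset.sum_mul, mul_smul_comm, smul_mul_assoc,
        Algebra.TensorProduct.tmul_mul_tmul, map_sum, LinearMap.sum_apply, map_smul,
        LinearMap.smul_apply, opFormSq_tmul, smul_eq_mul, ← mul_assoc]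
      exact h
    · intro x y hx hy
      rw [map_add, mul_add, map_add, hx, hy]
  · intro x y hx hy
    rw [add_mul, map_add, LinearMap.add_apply, hx, hy, map_add, LinearMap.add_apply]

/-- The operators that are intertwined by `G ⊗ G` form a subalgebra. -/
lemma opFormSq_adjoin_casimir {G : Operator} (hG : BasicBilinearIdentity G) {N : ℕ}
    {w : Cl ⊗[ℂ] Cl} (hw : w ∈ Algebra.adjoin ℂ {casimir N}) :
    w ∈ clTruncSq N ∧ ∀ A ∈ clTruncSq N, ∀ B ∈ clTruncSq N,
      opFormSq G (A * w) B = opFormSq G A (w * B) := by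
  induction hw using Algebra.adjoin_induction with
  | mem x hx =>
    rw [Set.mem_singleton_iff.mp hx]
    exact ⟨casimir_mem N, fun A hA B hB => opFormSq_casimir hG hA hB⟩
  | algebraMap r =>
    refine ⟨Subalgebra.algebraMap_mem _ _, fun A _ B _ => ?_⟩
    rw [← Algebra.commutes, ← Algebra.smul_def, ← Algebra.smul_def, map_smul, map_smul,
      LinearMap.smul_apply]
  | add x y _ _ hx hy =>
    refine ⟨add_mem hx.1 hy.1, fun A hA B hB => ?_⟩
    rw [mul_add, map_add, LinearMap.add_apply, hx.2 A hA B hB, hy.2 A hA B hB, add_mul, map_add]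
  | mul x y _ _ hx hy =>
    refine ⟨mul_mem hx.1 hy.1, fun A hA B hB => ?_⟩
    rw [← mul_assoc, hy.2 _ (mul_mem hA hx.1) B hB, hx.2 A hA _ (mul_mem hy.1 hB), mul_assoc]

lemma exists_mem_clTrunc (a : Cl) : ∃ N, a ∈ clTrunc N := by
  have hι : ∀ v : W, ∃ N, CliffordAlgebra.ι Q v ∈ clTrunc N := by
    intro v
    induction v using Finsupp.induction_linear with
    | zero => exact ⟨0, by simp⟩
    | add f g hf hg =>
      obtain ⟨M, hM⟩ := hf
      obtain ⟨N, hN⟩ := hg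
      refine ⟨max M N, ?_⟩
      rw [map_add]
      exact add_mem (clTrunc_mono (le_max_left _ _) hM) (clTrunc_mono (le_max_right _ _) hN)
    | single n c =>
      refine ⟨n.natAbs, ?_⟩
      rw [show Finsupp.single n c = c • Finsupp.single n (1 : ℂ) by simp, map_smul]
      exact Subalgebra.smul_mem _ (φ_mem_clTrunc (by simp)) _
  induction a using CliffordAlgebra.left_induction with
  | algebraMap r => exact ⟨0, Subalgebra.algebraMap_mem _ _⟩
  | add x y hx hy =>
    obtain ⟨M, hM⟩ := hx
    obtain ⟨N, hN⟩ := hy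
    exact ⟨max M N, add_mem (clTrunc_mono (le_max_left _ _) hM)
      (clTrunc_mono (le_max_right _ _) hN)⟩
  | ι_mul x v hx =>
    obtain ⟨M, hM⟩ := hx
    obtain ⟨N, hN⟩ := hι v
    exact ⟨max M N, mul_mem (clTrunc_mono (le_max_right _ _) hN)
      (clTrunc_mono (le_max_left _ _) hM)⟩

/-- The basic bilinear identity implies that `G ⊗ G` commutes with the tensor square of the
parity operator, which is `⟨0|a ↦ ⟨0|φ_0 a` on `F_B^*` and `b|0⟩ ↦ b φ_0|0⟩` on `F_B`. For a
single `G` this may fail. -/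
theorem opForm_parity {G : Operator} (hG : BasicBilinearIdentity G) (a a' b b' : Cl) :
    opForm G (φ 0 * a) b * opForm G (φ 0 * a') b'
      = opForm G a (b * φ 0) * opForm G a' (b' * φ 0) := by
  obtain ⟨N1, h1⟩ := exists_mem_clTrunc a
  obtain ⟨N2, h2⟩ := exists_mem_clTrunc a'
  obtain ⟨N3, h3⟩ := exists_mem_clTrunc b
  obtain ⟨N4, h4⟩ := exists_mem_clTrunc b'
  obtain ⟨N, hN⟩ : ∃ N, N = max (max N1 N2) (max N3 N4) := ⟨_, rfl⟩
  replace h1 := clTrunc_mono (by omega : N1 ≤ N) h1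
  replace h2 := clTrunc_mono (by omega : N2 ≤ N) h2
  replace h3 := clTrunc_mono (by omega : N3 ≤ N) h3
  replace h4 := clTrunc_mono (by omega : N4 ≤ N) h4
  have h := (opFormSq_adjoin_casimir hG (central_tmul_mem N)).2 _ (tmul_mem_clTruncSq h1 h2) _
    (tmul_mem_clTruncSq h3 h4)
  rw [Algebra.TensorProduct.tmul_mul_tmul, Algebra.TensorProduct.tmul_mul_tmul, opFormSq_tmul,
    opFormSq_tmul, central_comm h1, central_comm h2, ← central_comm h3, ← central_comm h4] at h
  simpa only [opForm_apply, mk_central_mul, mk_mul_central] using h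

/-! ### Coefficients of the formal series -/

lemma exists_sumElim {σ τ : Type} (d : σ ⊕ τ →₀ ℕ) : ∃ α β, d = Finsupp.sumElim α β :=
  ⟨_, _, (Finsupp.comapDomain_sumElim_comapDomain d).symm⟩

lemma coeff_rename_inl {σ τ R : Type} [DecidableEq τ] [CommSemiring R]
    (f : MvPowerSeries σ R) (α : σ →₀ ℕ) (β : τ →₀ ℕ) :
    MvPowerSeries.coeff (Finsupp.sumElim α β)
      (MvPowerSeries.rename (Function.Embedding.inl : σ ↪ σ ⊕ τ) f)
      = if β = 0 then MvPowerSeries.coeff α f else 0 := by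
  by_cases h : β = 0
  · subst h
    rw [if_pos rfl, ← Finsupp.embDomain_inl, MvPowerSeries.coeff_embDomain_rename]
  · rw [if_neg h]
    refine MvPowerSeries.coeff_rename_eq_zero _ _ ?_
    rintro ⟨x, hx⟩
    apply h
    ext k
    rw [← Finsupp.embDomain_eq_mapDomain, Finsupp.embDomain_inl] at hx
    exact (DFunLike.congr_fun hx (Sum.inr k)).symm

lemma coeff_rename_inr {σ τ R : Type} [DecidableEq σ] [CommSemiring R]
    (f : MvPowerSeries τ R) (α : σ →₀ ℕ) (β : τ →₀ ℕ) :
    MvPowerSeries.coeff (Finsupp.sumElim α β)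
      (MvPowerSeries.rename (Function.Embedding.inr : τ ↪ σ ⊕ τ) f)
      = if α = 0 then MvPowerSeries.coeff β f else 0 := by
  by_cases h : α = 0
  · subst h
    rw [if_pos rfl, ← Finsupp.embDomain_inr, MvPowerSeries.coeff_embDomain_rename]
  · rw [if_neg h]
    refine MvPowerSeries.coeff_rename_eq_zero _ _ ?_
    rintro ⟨x, hx⟩
    apply h
    ext k
    rw [← Finsupp.embDomain_eq_mapDomain, Finsupp.embDomain_inr] at hx
    exact (DFunLike.congr_fun hx (Sum.inl k)).symm

lemma coeff_rename_mul_rename {σ τ R : Type} [CommSemiring R] (f : MvPowerSeries σ R)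
    (g : MvPowerSeries τ R) (α : σ →₀ ℕ) (β : τ →₀ ℕ) :
    MvPowerSeries.coeff (Finsupp.sumElim α β)
      (MvPowerSeries.rename (Function.Embedding.inl : σ ↪ σ ⊕ τ) f
        * MvPowerSeries.rename (Function.Embedding.inr : τ ↪ σ ⊕ τ) g)
      = MvPowerSeries.coeff α f * MvPowerSeries.coeff β g := by
  classical
  rw [MvPowerSeries.coeff_mul, Finset.sum_eq_single (Finsupp.sumElim α 0, Finsupp.sumElim 0 β)]
  · rw [coeff_rename_inl, coeff_rename_inr, if_pos rfl, if_pos rfl]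
  · rintro ⟨p, q⟩ hpq hne
    rw [Finset.HasAntidiagonal.mem_antidiagonal] at hpq
    obtain ⟨a, b, rfl⟩ := exists_sumElim p
    obtain ⟨c, d, rfl⟩ := exists_sumElim q
    rw [coeff_rename_inl, coeff_rename_inr]
    by_cases hb : b = 0
    · by_cases hc : c = 0
      · subst hb hc
        exfalso
        apply hne
        have h1 : a = α := by
          ext k; simpa using DFunLike.congr_fun hpq (Sum.inl k)
        have h2 : d = β := by
          ext k; simpa using DFunLike.congr_fun hpq (Sum.inr k)
        rw [h1, h2]
      · rw [if_neg hc, mul_zero]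
    · rw [if_neg hb, zero_mul]
  · intro h
    exfalso
    apply h
    rw [Finset.HasAntidiagonal.mem_antidiagonal, ← Finsupp.sumElim_add, add_zero, zero_add]

/-- The multinomial theorem for the powers of a homogeneous linear series. -/
lemma coeff_linear_pow {σ R : Type} [CommRing R] [Algebra ℂ R] (L : MvPowerSeries σ R)
    (hL : ∀ d, (∀ x, d ≠ Finsupp.single x 1) → MvPowerSeries.coeff d L = 0) (n : ℕ) (d : σ →₀ ℕ) :
    MvPowerSeries.coeff d (L ^ n) = if d.degree = n then ((n.factorial : ℂ) * (mfact d)⁻¹) •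
      d.prod (fun x m => MvPowerSeries.coeff (Finsupp.single x 1) L ^ m) else 0 := by
  classical
  induction n generalizing d with
  | zero =>
    rw [pow_zero, MvPowerSeries.coeff_one]
    by_cases h : d = 0
    · subst h; simp
    · rw [if_neg h, if_neg fun h' => h ((Finsupp.degree_eq_zero_iff d).mp h')]
  | succ n ih =>
    rw [pow_succ', MvPowerSeries.coeff_mul]
    have h1 : ∑ x ∈ d.support, MvPowerSeries.coeff (Finsupp.single x 1) L *
        MvPowerSeries.coeff (d - Finsupp.single x 1) (L ^ n)
        = ∑ p ∈ Finset.HasAntidiagonal.antidiagonal d, MvPowerSeries.coeff p.1 L *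
          MvPowerSeries.coeff p.2 (L ^ n) := by
      refine Finset.sum_of_injOn (fun x => (Finsupp.single x 1, d - Finsupp.single x 1))
        ?_ ?_ ?_ ?_
      · intro a _ b _ h
        exact Finsupp.single_left_injective one_ne_zero (congrArg Prod.fst h)
      · intro x hx
        rw [Finset.mem_coe, Finset.HasAntidiagonal.mem_antidiagonal]
        exact add_tsub_cancel_of_le (Finsupp.single_le_iff.mpr
          (Nat.one_le_iff_ne_zero.mpr (Finsupp.mem_support_iff.mp hx)))
      · rintro ⟨p, q⟩ hpq hn
        rw [Finset.HasAntidiagonal.mem_antidiagonal] at hpq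
        dsimp only at hpq ⊢
        rw [hL p, zero_mul]
        rintro x rfl
        apply hn
        refine ⟨x, ?_, ?_⟩
        · rw [Finset.mem_coe, Finsupp.mem_support_iff, ← hpq]
          simp
        · exact Prod.ext rfl (by rw [← hpq]; exact add_tsub_cancel_left _ _)
      · intros; rfl
    rw [← h1]
    have hterm : ∀ x ∈ d.support, MvPowerSeries.coeff (Finsupp.single x 1) L *
        MvPowerSeries.coeff (d - Finsupp.single x 1) (L ^ n) = if d.degree = n + 1 then
          (d x : ℂ) • (((n.factorial : ℂ) * (mfact d)⁻¹) •
            d.prod (fun x m => MvPowerSeries.coeff (Finsupp.single x 1) L ^ m)) else 0 := by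
      intro x hx
      have hx1 : Finsupp.single x 1 ≤ d := Finsupp.single_le_iff.mpr
          (Nat.one_le_iff_ne_zero.mpr (Finsupp.mem_support_iff.mp hx))
      obtain ⟨e, rfl⟩ := exists_add_of_le hx1
      rw [add_tsub_cancel_left, ih]
      simp only [map_add, Finsupp.degree_single]
      by_cases h : e.degree = n
      · have hne : (e x : ℂ) + 1 ≠ 0 := Nat.cast_add_one_ne_zero _
        have := mfact_ne_zero e
        rw [if_pos h, if_pos (by omega), add_comm _ e, prod_add_single (fun x m =>
          MvPowerSeries.coeff (Finsupp.single x 1) L ^ m) (fun _ => pow_zero _) e x _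
          (pow_succ' _ _), mfact_add_single, mul_smul_comm, smul_smul]
        congr 1
        simp only [Finsupp.add_apply, Finsupp.single_eq_same]
        push_cast
        field_simp
      · rw [if_neg h, if_neg (by omega), mul_zero]
    rw [Finset.sum_congr rfl hterm]
    by_cases h : d.degree = n + 1
    · simp only [h, if_true]
      rw [← Finset.sum_smul, smul_smul, ← Nat.cast_sum]
      have h2 : ∑ i ∈ d.support, d i = n + 1 := h
      rw [h2, Nat.factorial_succ]
      push_cast
      congr 1
      ring
    · simp [h]

/-- The coefficients of the exponential of a homogeneous linear series. -/
lemma coeff_exp_linear {σ R : Type} [CommRing R] [Algebra ℂ R] (L : MvPowerSeries σ R)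
    (hL : ∀ d, (∀ x, d ≠ Finsupp.single x 1) → MvPowerSeries.coeff d L = 0)
    (hs : PowerSeries.HasSubst L) (d : σ →₀ ℕ) :
    MvPowerSeries.coeff d ((PowerSeries.exp ℂ).subst L) = (mfact d)⁻¹ •
      d.prod (fun x m => MvPowerSeries.coeff (Finsupp.single x 1) L ^ m) := by
  rw [PowerSeries.coeff_subst hs, finsum_eq_single _ d.degree]
  · rw [coeff_linear_pow L hL, if_pos rfl, smul_smul, PowerSeries.coeff_exp]
    congr 1
    have : (d.degree.factorial : ℂ) ≠ 0 := Nat.cast_ne_zero.mpr (Nat.factorial_ne_zero _)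
    simp
    field_simp
  · intro n hn
    rw [coeff_linear_pow L hL, if_neg hn.symm, smul_zero]

lemma mfact_sumElim {σ τ : Type} (α : σ →₀ ℕ) (β : τ →₀ ℕ) :
    mfact (Finsupp.sumElim α β) = mfact α * mfact β := Finsupp.prod_sumElim _ _ _

lemma algebraMap_mul_single (c : ℂ) (n : ℤ) (r : ℂ) :
    algebraMap ℂ (LaurentSeries ℂ) c * HahnSeries.single n r = HahnSeries.single n (c * r) := by
  rw [HahnSeries.algebraMap_apply']
  simp

/-- For `ε = ±1`, the series `e^{ε ξ(t,z)}`, given by its coefficients. -/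
def expXi (ε : ℂ) : MvPowerSeries OddIdx (LaurentSeries ℂ) := fun α =>
  HahnSeries.single (-(wt α : ℤ)) (ε ^ wt α * (mfact α)⁻¹)

lemma prod_single_pow {ε : ℂ} (hε : ε = 1 ∨ ε = -1) (α : OddIdx →₀ ℕ) :
    α.prod (fun k m => (HahnSeries.single (-(k.1 : ℤ)) ε : LaurentSeries ℂ) ^ m)
      = HahnSeries.single (-(wt α : ℤ)) (ε ^ wt α) := by
  induction α using multiIndex_induction with
  | h0 => simp
  | hs α k ih =>
    rw [prod_add_single (fun (k : OddIdx) m => (HahnSeries.single (-(k.1 : ℤ)) ε :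
      LaurentSeries ℂ) ^ m) (fun _ => pow_zero _) α k _ (pow_succ' _ _), ih,
      HahnSeries.single_mul_single, wt_add, wt_single]
    congr 1
    · push_cast; ring_nf
    · have : ε ^ k.1 = ε := by
        rcases hε with rfl | rfl
        · simp
        · exact k.2.neg_one_pow
      rw [one_mul, pow_add, this]; ring

lemma coeff_single_xiDiff_inl (k : OddIdx) :
    MvPowerSeries.coeff (Finsupp.single (Sum.inl k) 1) xiDiff = HahnSeries.single (-(k.1 : ℤ)) 1 := by
  classical
  show (∑ᶠ j : OddIdx, _) = _
  rw [finsum_eq_single _ k]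
  · simp [MvPowerSeries.coeff_X, Finsupp.single_left_inj]
  · intro j hj
    simp [MvPowerSeries.coeff_X, Finsupp.single_left_inj, hj.symm]

lemma coeff_single_xiDiff_inr (k : OddIdx) :
    MvPowerSeries.coeff (Finsupp.single (Sum.inr k) 1) xiDiff
      = HahnSeries.single (-(k.1 : ℤ)) (-1) := by
  classical
  show (∑ᶠ j : OddIdx, _) = _
  rw [finsum_eq_single _ k]
  · rw [map_sub, MvPowerSeries.coeff_X, MvPowerSeries.coeff_X, if_neg (by
      simp [Finsupp.single_left_inj]), if_pos rfl, zero_sub]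
    rw [show (-1 : LaurentSeries ℂ) = HahnSeries.single 0 (-1) by simp]
    exact (HahnSeries.single_mul_single (Γ := ℤ)).trans (by simp)
  · intro j hj
    simp [MvPowerSeries.coeff_X, Finsupp.single_left_inj, hj.symm]

lemma coeff_xiDiff_eq_zero (d : OddIdx ⊕ OddIdx →₀ ℕ) (hd : ∀ x, d ≠ Finsupp.single x 1) :
    MvPowerSeries.coeff d xiDiff = 0 := by
  classical
  show (∑ᶠ j : OddIdx, _) = _
  refine finsum_eq_zero_of_forall_eq_zero fun k => ?_
  simp [MvPowerSeries.coeff_X, hd]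

/-- `e^{ξ(t-t',z)} = e^{ξ(t,z)} e^{-ξ(t',z)}`. -/
lemma expXiDiff_eq : expXiDiff = MvPowerSeries.rename Function.Embedding.inl (expXi 1)
    * MvPowerSeries.rename Function.Embedding.inr (expXi (-1)) := by
  ext1 d
  obtain ⟨α, β, rfl⟩ := exists_sumElim d
  rw [coeff_rename_mul_rename, expXiDiff, coeff_exp_linear _ coeff_xiDiff_eq_zero hasSubst_xiDiff,
    Finsupp.prod_sumElim, mfact_sumElim]
  have h1 : α.prod ((fun x m => MvPowerSeries.coeff (Finsupp.single x 1) xiDiff ^ m) ∘ Sum.inl)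
      = HahnSeries.single (-(wt α : ℤ)) (1 ^ wt α) := by
    rw [← prod_single_pow (Or.inl rfl)]
    simp only [Function.comp_def, coeff_single_xiDiff_inl]
  have h2 : β.prod ((fun x m => MvPowerSeries.coeff (Finsupp.single x 1) xiDiff ^ m) ∘ Sum.inr)
      = HahnSeries.single (-(wt β : ℤ)) ((-1) ^ wt β) := by
    rw [← prod_single_pow (Or.inr rfl)]
    simp only [Function.comp_def, coeff_single_xiDiff_inr]
  rw [h1, h2]
  show _ = HahnSeries.single (-(wt α : ℤ)) (1 ^ wt α * (mfact α)⁻¹)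
    * HahnSeries.single (-(wt β : ℤ)) ((-1) ^ wt β * (mfact β)⁻¹)
  rw [HahnSeries.single_mul_single, HahnSeries.single_mul_single]
  refine (Algebra.smul_def _ _).trans ((algebraMap_mul_single _ _ _).trans ?_)
  congr 1
  rw [mul_inv]
  ring

/-- The multi-binomial theorem for the shifted times. -/
lemma prod_shiftedTimes (s : ℂ) (d : OddIdx →₀ ℕ) :
    (mfact d)⁻¹ • d.prod (fun k n => shiftedTimes s k ^ n)
      = ∑ p ∈ Finset.HasAntidiagonal.antidiagonal d, ((mfact p.1)⁻¹ * (mfact p.2)⁻¹ *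
        miwaCoeff s p.2) • MvPowerSeries.monomial (Finsupp.optionElim (wt p.2) p.1) (1 : ℂ) := by
  induction d using multiIndex_induction with
  | h0 => simp [miwaCoeff]
  | hs d k ih =>
    have hne : ∀ a : OddIdx →₀ ℕ, (a k : ℂ) + 1 ≠ 0 := fun a => Nat.cast_add_one_ne_zero _
    apply smul_right_injective _ (hne d)
    show ((d k : ℂ) + 1) • _ = ((d k : ℂ) + 1) • _
    have h1 : ((d k : ℂ) + 1) • ((mfact (d + Finsupp.single k 1))⁻¹ •
        (d + Finsupp.single k 1).prod (fun k n => shiftedTimes s k ^ n))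
        = shiftedTimes s k * ((mfact d)⁻¹ • d.prod (fun k n => shiftedTimes s k ^ n)) := by
      rw [prod_add_single (fun k n => shiftedTimes s k ^ n) (fun _ => pow_zero _) d k _
        (pow_succ' _ _), mfact_add_single, smul_smul,
        mul_smul_comm, mul_inv, mul_inv_cancel_left₀ (hne d)]
    set F : (OddIdx →₀ ℕ) → (OddIdx →₀ ℕ) → MvPowerSeries (Option OddIdx) ℂ := fun a b =>
      ((mfact a)⁻¹ * (mfact b)⁻¹ * miwaCoeff s b) •
        MvPowerSeries.monomial (Finsupp.optionElim (wt b) a) (1 : ℂ) with hF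
    have hsplit : ∀ p ∈ Finset.HasAntidiagonal.antidiagonal (d + Finsupp.single k 1 : OddIdx →₀ ℕ),
        ((d k : ℂ) + 1) • F p.1 p.2 = (p.1 k : ℂ) • F p.1 p.2 + (p.2 k : ℂ) • F p.1 p.2 := by
      intro p hp
      rw [← add_smul]
      congr 1
      have := congrArg (fun a => ((a k : ℕ) : ℂ)) (Finset.HasAntidiagonal.mem_antidiagonal.mp hp)
      simpa using this.symm
    have hX : ∀ a b, shiftedTimes s k * F a b = ((a k : ℂ) + 1) • F (a + Finsupp.single k 1) b
        + ((b k : ℂ) + 1) • F a (b + Finsupp.single k 1) := by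
      intro a b
      simp only [hF]
      rw [shiftedTimes, add_mul, mfact_add_single, mfact_add_single, miwaCoeff_add_single, wt_add,
        wt_single, one_mul, smul_smul, smul_smul]
      congr 1
      · rw [show ((a k : ℂ) + 1) * ((((a k : ℂ) + 1) * mfact a)⁻¹ * (mfact b)⁻¹ * miwaCoeff s b)
            = (mfact a)⁻¹ * (mfact b)⁻¹ * miwaCoeff s b by
              rw [mul_inv, mul_assoc, mul_assoc, mul_inv_cancel_left₀ (hne a), ← mul_assoc],
          mul_smul_comm, MvPowerSeries.X, MvPowerSeries.monomial_mul_monomial, one_mul]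
        congr 3
        refine Finsupp.ext fun i => ?_
        cases i <;> simp [add_comm, Finsupp.single_apply]
      · have hm : MvPowerSeries.X none ^ k.1 * MvPowerSeries.monomial (Finsupp.optionElim (wt b) a)
            (1 : ℂ) = MvPowerSeries.monomial (Finsupp.optionElim (wt b + k.1) a) (1 : ℂ) := by
          rw [MvPowerSeries.X_pow_eq, MvPowerSeries.monomial_mul_monomial, one_mul]
          congr 2
          refine Finsupp.ext fun i => ?_
          cases i <;> simp [add_comm]
        rw [mul_assoc (MvPowerSeries.C _), mul_smul_comm, hm, mul_smul_comm,
          ← MvPowerSeries.smul_eq_C_mul, smul_smul]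
        congr 1
        have := hne b
        field_simp
    rw [h1, ih, Finset.smul_sum, Finset.sum_congr rfl hsplit, Finset.sum_add_distrib,
      sum_antidiagonal_fst d k F, sum_antidiagonal_snd d k F, ← Finset.sum_add_distrib,
      Finset.mul_sum]
    exact Finset.sum_congr rfl fun p _ => hX p.1 p.2

lemma optionElim_inj {m n : ℕ} {α β : OddIdx →₀ ℕ} :
    Finsupp.optionElim m α = Finsupp.optionElim n β ↔ m = n ∧ α = β := by
  constructor
  · intro h
    constructor
    · simpa using DFunLike.congr_fun h none
    · rw [← Finsupp.some_optionElim m α, h, Finsupp.some_optionElim]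
  · rintro ⟨rfl, rfl⟩; rfl

/-- Taylor's formula for `f(t + s[w])`. -/
lemma coeff_miwaShift (s : ℂ) (f : TimeSeries) (α : OddIdx →₀ ℕ) (m : ℕ) :
    MvPowerSeries.coeff (Finsupp.optionElim m α) (f.subst (shiftedTimes s))
      = ∑ γ ∈ wtEq m, MvPowerSeries.coeff (α + γ) f * (mfact (α + γ) * ((mfact α)⁻¹ * (mfact γ)⁻¹ *
        miwaCoeff s γ)) := by
  classical
  have hcoeff : ∀ d : OddIdx →₀ ℕ, MvPowerSeries.coeff (Finsupp.optionElim m α)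
      (d.prod fun k n => shiftedTimes s k ^ n) = mfact d *
        ∑ p ∈ Finset.HasAntidiagonal.antidiagonal d, if p.1 = α ∧ wt p.2 = m then
          (mfact p.1)⁻¹ * (mfact p.2)⁻¹ * miwaCoeff s p.2 else 0 := by
    intro d
    rw [← smul_inv_smul₀ (mfact_ne_zero d) (d.prod fun k n => shiftedTimes s k ^ n),
      prod_shiftedTimes, map_smul, map_sum, smul_eq_mul]
    congr 1
    refine Finset.sum_congr rfl fun p _ => ?_
    rw [map_smul, MvPowerSeries.coeff_monomial, smul_eq_mul]
    simp only [optionElim_inj, mul_ite, mul_one, mul_zero]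
    refine if_congr ⟨fun h => ⟨h.2.symm, h.1.symm⟩, fun h => ⟨h.2.symm, h.1.symm⟩⟩ rfl rfl
  rw [MvPowerSeries.coeff_subst (hasSubst_shiftedTimes s)]
  simp only [hcoeff]
  rw [finsum_eq_sum_of_support_subset (s := (wtEq m).image (α + ·)),
    Finset.sum_image (fun a _ b _ h => add_left_cancel h)]
  · refine Finset.sum_congr rfl fun γ hγ => ?_
    rw [mem_wtEq] at hγ
    rw [smul_eq_mul, Finset.sum_eq_single (α, γ), if_pos ⟨rfl, hγ⟩]
    · rintro ⟨p, q⟩ hp hne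
      rw [Finset.HasAntidiagonal.mem_antidiagonal] at hp
      refine if_neg fun h => hne ?_
      have h1 : p = α := h.1
      have h2 : p + q = α + γ := hp
      rw [h1] at h2
      rw [h1, add_left_cancel h2]
    · intro h
      simp at h
  · intro d hd
    rw [Function.mem_support] at hd
    by_contra hc
    apply hd
    rw [Finset.sum_eq_zero, mul_zero, smul_zero]
    rintro ⟨p, q⟩ hp
    rw [Finset.HasAntidiagonal.mem_antidiagonal] at hp
    refine if_neg fun h => hc ?_
    obtain ⟨rfl, h⟩ := h
    exact Finset.mem_coe.mpr (Finset.mem_image.mpr ⟨q, mem_wtEq.mpr h, hp⟩)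

lemma hexp_hexp (α β : OddIdx →₀ ℕ) (U : Bra) :
    hexp α (hexp β U) = (mfact (α + β) * ((mfact α)⁻¹ * (mfact β)⁻¹)) • hexp (α + β) U := by
  have h : hamExp α * hamExp β = (mfact (α + β) * ((mfact α)⁻¹ * (mfact β)⁻¹)) •
      hamExp (α + β) := by
    have := mfact_ne_zero (α + β)
    rw [hamExp, hamExp, hamExp, smul_mul_smul_comm, smul_smul,
      Finsupp.prod_add_index' (by simp) (by intros; rw [pow_add])]
    congr 1
    field_simp
  exact congrArg (fun x : HamAlg => x.1 U) h

/-- The series `ℓ(⟨0|e^{H_+(t)})` for a linear functional `ℓ` on `F_B^*`. -/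
def vacSeries (l : Bra →ₗ[ℂ] ℂ) : TimeSeries := fun α => l (hexp α vacBra)

/-- `ℓ(⟨0|e^{H_+(t + s[w])}) = ℓ(⟨0|e^{H_+(s[w])} e^{H_+(t)})`. -/
lemma miwaShift_vacSeries (s : ℂ) (l : Bra →ₗ[ℂ] ℂ) (α : OddIdx →₀ ℕ) :
    miwaShift s (vacSeries l) α = PowerSeries.mk fun m => l (hexp α (vacMiwa s m)) := by
  unfold miwaShift
  congr 1
  ext m
  rw [coeff_miwaShift, vacMiwa, map_sum, map_sum]
  refine Finset.sum_congr rfl fun γ _ => ?_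
  rw [map_smul, hexp_hexp, map_smul, map_smul, smul_eq_mul, smul_eq_mul]
  show l (hexp (α + γ) vacBra) * _ = _
  ring

/-- The boson-fermion correspondence `e^{εξ(t,z)} ⟨0|e^{H_+(t - ε[z⁻¹])} = 2⟨0|φ_0 e^{H_+(t)} φ(εz)`
for `ε = ±1`, by coefficients. -/
lemma coeff_expXi_mul_miwaShift {ε : ℂ} (hε : ε = 1 ∨ ε = -1) (l : Bra →ₗ[ℂ] ℂ)
    (α : OddIdx →₀ ℕ) (j : ℤ) :
    (MvPowerSeries.coeff α (expXi ε * MvPowerSeries.map (HahnSeries.ofPowerSeries ℤ ℂ)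
      (miwaShift (-ε) (vacSeries l)))).coeff (-j)
      = ε ^ j * (2 * l (braφ j (hexp α (braZero vacBra)))) := by
  classical
  have hε0 : ε ≠ 0 := by rcases hε with rfl | rfl <;> norm_num
  have hε2 : ε * ε = 1 := by rcases hε with rfl | rfl <;> norm_num
  have hv : ∀ m, vacMiwa (-ε) m = ε ^ m • vacMiwa (-1) m := by
    intro m
    rcases hε with rfl | rfl
    · simp
    · rw [neg_neg, vacMiwa_one]
  have hvac : ∀ n : ℤ, 0 < n → braφ n (braZero vacBra) = 0 := fun n hn => by
    rw [← braZero_braφ, braφ_vacBra hn, map_zero]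
  -- For `wt p.1 < j` both sides vanish: the left one has no positive power of `z`, and on the
  -- right `φ_n` with `n > 0` annihilates the left vacuum.
  have hterm : ∀ p ∈ Finset.HasAntidiagonal.antidiagonal α,
      (MvPowerSeries.coeff p.1 (expXi ε) * MvPowerSeries.coeff p.2 (MvPowerSeries.map
        (HahnSeries.ofPowerSeries ℤ ℂ) (miwaShift (-ε) (vacSeries l)))).coeff (-j)
      = ε ^ j * (2 * l ((mfact p.1)⁻¹ • hexp p.2 (braφ (j - wt p.1) (braZero vacBra)))) := by
    intro p _
    rw [MvPowerSeries.coeff_map]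
    show (HahnSeries.single (-(wt p.1 : ℤ)) (ε ^ wt p.1 * (mfact p.1)⁻¹) *
      HahnSeries.ofPowerSeries ℤ ℂ (miwaShift (-ε) (vacSeries l) p.2)).coeff (-j) = _
    rw [HahnSeries.coeff_single_mul, miwaShift_vacSeries, map_smul, smul_eq_mul]
    rcases lt_or_ge (wt p.1 : ℤ) j with h | h
    · have h1 : -j - -(wt p.1 : ℤ) < 0 := by omega
      rw [PowerSeries.coeff_coe, if_pos h1, hvac _ (by omega)]
      simp
    · obtain ⟨m, hm⟩ := Int.eq_ofNat_of_zero_le (show 0 ≤ (wt p.1 : ℤ) - j by omega)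
      rw [show -j - -(wt p.1 : ℤ) = (m : ℤ) by omega, HahnSeries.ofPowerSeries_apply_coeff,
        PowerSeries.coeff_mk, hv, vacMiwa_neg_one, map_smul, map_smul, map_smul, map_smul,
        show j - (wt p.1 : ℤ) = -(m : ℤ) by omega]
      have h2 : ε ^ wt p.1 * ε ^ m = ε ^ j := by
        have h3 : (wt p.1 : ℤ) = j + m := by omega
        rw [← zpow_natCast ε (wt p.1), h3, zpow_add₀ hε0, zpow_natCast, mul_assoc, ← mul_pow, hε2,
          one_pow, mul_one]
      rw [← h2]
      simp only [smul_eq_mul]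
      ring
  rw [MvPowerSeries.coeff_mul, HahnSeries.coeff_sum, Finset.sum_congr rfl hterm, braφ_hexp,
    ← Finset.mul_sum, ← Finset.mul_sum, map_sum]
  congr 2
  exact Finset.sum_equiv (Equiv.prodComm _ _) (by simp [add_comm]) (by simp)

/-- The constant coefficient of a product of Laurent series, as a sum over all integers. -/
lemma coeff_zero_mul (x y : LaurentSeries ℂ) :
    (x * y).coeff 0 = ∑ᶠ n : ℤ, x.coeff (-n) * y.coeff n := by
  classical
  rw [HahnSeries.coeff_mul]
  have hsub : (Function.support fun n : ℤ => x.coeff (-n) * y.coeff n) ⊆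
      ((Finset.antidiagonal x.isPWO_support y.isPWO_support 0).image Prod.snd : Finset ℤ) := by
    intro n hn
    rw [Function.mem_support] at hn
    refine Finset.mem_coe.mpr (Finset.mem_image.mpr ⟨(-n, n), ?_, rfl⟩)
    rw [Finset.mem_antidiagonal]
    exact ⟨left_ne_zero_of_mul hn, right_ne_zero_of_mul hn, by simp⟩
  have hmem : ∀ p ∈ Finset.antidiagonal x.isPWO_support y.isPWO_support 0, p.1 = -p.2 :=
    fun p hp => eq_neg_of_add_eq_zero_left (Finset.mem_antidiagonal.mp hp).2.2
  rw [finsum_eq_sum_of_support_subset _ hsub, Finset.sum_image]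
  · exact Finset.sum_congr rfl fun p hp => by rw [hmem p hp]
  · intro p hp q hq h
    exact Prod.ext (by rw [hmem p hp, hmem q hq, h]) h

/-! ### The residue -/

/-- The functional `U ↦ ⟨U|G|V⟩`. -/
def matrixFunctional (G : Operator) (V : Ket) : Bra →ₗ[ℂ] ℂ := G V

lemma matrixFunctional_apply (G : Operator) (V : Ket) (U : Bra) :
    matrixFunctional G V U = matrixElement U G V := rfl

/-- The parity relation `opForm_parity` for arbitrary vectors of `F_B^*`. -/
lemma matrixElement_parity {G : Operator} (hG : BasicBilinearIdentity G) (U U' : Bra) (b b' : Cl) :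
    matrixElement (braZero U) G (Submodule.Quotient.mk b)
        * matrixElement (braZero U') G (Submodule.Quotient.mk b')
      = matrixElement U G (Submodule.Quotient.mk (b * φ 0))
        * matrixElement U' G (Submodule.Quotient.mk (b' * φ 0)) := by
  obtain ⟨a, rfl⟩ := Submodule.Quotient.mk_surjective _ U
  obtain ⟨a', rfl⟩ := Submodule.Quotient.mk_surjective _ U'
  exact opForm_parity hG a a' b b'

lemma φ_zero_mul_φ_zero : φ 0 * φ 0 = algebraMap ℂ Cl (1 / 2) := by
  have h := φ_anticomm 0 0
  rw [← two_smul ℂ] at h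
  have h' : φ 0 * φ 0 = (1 / 2 : ℂ) • ((2 : ℂ) • (φ 0 * φ 0)) := by rw [smul_smul]; norm_num
  rw [h', h, Algebra.smul_def, ← map_mul]
  simp

lemma φ_zero_smul_φ_zero_smul_vacKet : φ 0 • φ 0 • vacKet = (1 / 2 : ℂ) • vacKet := by
  rw [smul_smul, φ_zero_mul_φ_zero, algebraMap_smul]

lemma φ_smul_vacKet {n : ℤ} (hn : n < 0) : φ n • vacKet = 0 :=
  (Submodule.Quotient.mk_eq_zero _).mpr (by
    show φ n * 1 ∈ ketIdeal
    rw [mul_one]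
    exact Submodule.subset_span ⟨n, hn, rfl⟩)

lemma matrixElement_smul (U : Bra) (G : Operator) (c : ℂ) (V : Ket) :
    matrixElement U G (c • V) = c * matrixElement U G V := by
  rw [matrixElement, map_smul]; rfl

lemma matrixElement_zero (U : Bra) (G : Operator) : matrixElement U G 0 = 0 := by
  rw [matrixElement, map_zero]; rfl

/-- The basic bilinear identity between the vacuum vectors, where the right hand side has a single
non-zero term. -/
lemma basicBilinear_vacuum {G : Operator} (hG : BasicBilinearIdentity G) (U U' : Bra) :
    ∑ᶠ n : ℤ, (-1 : ℂ) ^ n * matrixElement (braφ n U) G (φ 0 • vacKet)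
        * matrixElement (braφ (-n) U') G vacKet
      = 1 / 2 * matrixElement U G vacKet * matrixElement U' G (φ 0 • vacKet) := by
  refine (hG U U' (φ 0 • vacKet) vacKet).symm.trans ?_
  rw [finsum_eq_single _ 0]
  · rw [φ_zero_smul_φ_zero_smul_vacKet, matrixElement_smul]
    simp
  · intro n hn
    rcases lt_or_gt_of_ne hn with h | h
    · have h1 := φ_anticomm_of_ne (m := n) (n := 0) (by omega)
      rw [smul_smul, h1, neg_smul, mul_smul, φ_smul_vacKet h, smul_zero, neg_zero,
        matrixElement_zero]
      ring
    · rw [φ_smul_vacKet (show -n < 0 by omega), matrixElement_zero, mul_zero]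

/-- Moving `φ_k` through the bilinear sum `∑_n (-1)^n φ_n ⊗ φ_{-n}`. -/
lemma bilinear_sum_φ {G : Operator} (hG : BasicBilinearIdentity G) (U U' : Bra) (k : ℤ) :
    ∑ᶠ n : ℤ, (-1 : ℂ) ^ n * matrixElement (braφ k (braφ n U)) G (φ 0 • vacKet)
        * matrixElement (braφ (-n) U') G vacKet
      = matrixElement U G (φ 0 • vacKet) * matrixElement (braφ k U') G vacKet
        - 1 / 2 * matrixElement (braφ k U) G vacKet * matrixElement U' G (φ 0 • vacKet) := by
  rw [← basicBilinear_vacuum hG]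
  have hterm : ∀ n : ℤ, (-1 : ℂ) ^ n * matrixElement (braφ k (braφ n U)) G (φ 0 • vacKet)
        * matrixElement (braφ (-n) U') G vacKet
      = (if n = -k then matrixElement U G (φ 0 • vacKet) * matrixElement (braφ k U') G vacKet
          else 0)
        - (-1 : ℂ) ^ n * matrixElement (braφ n (braφ k U)) G (φ 0 • vacKet)
          * matrixElement (braφ (-n) U') G vacKet := by
    intro n
    have h := eq_sub_of_add_eq (braφ_anticomm n k U)
    rw [h, ← matrixFunctional_apply, map_sub, map_smul, matrixFunctional_apply,
      matrixFunctional_apply, smul_eq_mul]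
    by_cases hn : n = -k
    · subst hn
      rw [if_pos rfl, if_pos rfl, neg_neg]
      linear_combination matrixElement U G (φ 0 • vacKet) * matrixElement (braφ k U') G vacKet *
        neg_one_zpow_mul_self (-k)
    · rw [if_neg hn, if_neg hn]
      ring
  have hfin : (Function.support fun n : ℤ => (-1 : ℂ) ^ n *
      matrixElement (braφ n (braφ k U)) G (φ 0 • vacKet)
        * matrixElement (braφ (-n) U') G vacKet).Finite :=
    finite_support_bra G (braφ k U) U' _ _
  rw [finsum_congr hterm, finsum_sub_distrib ?_ hfin,
    finsum_eq_single _ (-k) (fun n hn => if_neg hn), if_pos rfl]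
  exact (Set.finite_singleton (-k)).subset fun i hi => by
    by_contra h; exact hi (if_neg h)

lemma tau_eq (G : Operator) : tau G = vacSeries (matrixFunctional G vacKet) := by
  funext α
  rw [tau, vacExp_eq]
  rfl

lemma tauNext_eq (G : Operator) (k : ℤ) : tauNext G k
    = vacSeries ((2 : ℂ) • matrixFunctional G (φ 0 • vacKet) ∘ₗ braφ k) := by
  funext α
  rw [tauNext, vacExp_eq]
  rfl

/-- The bilinear identity for the coefficients of `t^α t'^β`, where `U` and `U'` are the
coefficients of `t^α` in `⟨0|e^{H_+(t)}` and of `t'^β` in `⟨0|e^{H_+(t')}`. The sum over `n` is the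
residue. -/
lemma coeff_bilinear {G : Operator} (hG : BasicBilinearIdentity G) (k : ℤ) (U U' : Bra) :
    ∑ᶠ n : ℤ, (2 * (2 * matrixElement (braφ k (braφ n (braZero U))) G (φ 0 • vacKet)))
        * ((-1 : ℂ) ^ n * (2 * matrixElement (braφ (-n) (braZero U')) G vacKet))
      = 2 * matrixElement U G vacKet * (2 * matrixElement (braφ k U') G (φ 0 • vacKet))
        - 2 * matrixElement (braφ k U) G (φ 0 • vacKet) * matrixElement U' G vacKet := by
  have h1 : ∀ n : ℤ, (2 * (2 * matrixElement (braφ k (braφ n (braZero U))) G (φ 0 • vacKet)))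
        * ((-1 : ℂ) ^ n * (2 * matrixElement (braφ (-n) (braZero U')) G vacKet))
      = 8 * ((-1 : ℂ) ^ n * matrixElement (braφ k (braφ n (braZero U))) G (φ 0 • vacKet)
        * matrixElement (braφ (-n) (braZero U')) G vacKet) := fun n => by ring
  have hz : φ 0 • vacKet = Submodule.Quotient.mk (1 * φ 0) := by
    rw [one_mul, vacKet, ← Submodule.Quotient.mk_smul, smul_eq_mul, mul_one]
  have hz2 : (Submodule.Quotient.mk (1 * φ 0 * φ 0) : Ket) = (1 / 2 : ℂ) • vacKet := by
    rw [one_mul, φ_zero_mul_φ_zero, Algebra.algebraMap_eq_smul_one, Submodule.Quotient.mk_smul]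
    rfl
  -- `U ↦ ⟨0|φ_0 ⋯` on both factors is traded for `φ_0` on the right vacua, with `φ_0² = 1/2`.
  have p1 := matrixElement_parity hG U (braφ k U') (1 * φ 0) 1
  have p2 := matrixElement_parity hG (braφ k U) U' 1 (1 * φ 0)
  rw [hz2, ← hz, matrixElement_smul, braZero_braφ] at p1 p2
  rw [finsum_congr h1, ← mul_finsum, bilinear_sum_φ hG]
  change matrixElement _ G (φ 0 • vacKet) * matrixElement _ G vacKet = _ at p1
  change matrixElement _ G vacKet * matrixElement _ G (φ 0 • vacKet) = _ at p2
  linear_combination 8 * p1 - 4 * p2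

end

end BKP

theorem mainTheorem5 (G : BKP.Operator) (hG : BKP.BasicBilinearIdentity G) (k : ℤ) :
    BKP.residue (BKP.expXiDiff * BKP.shiftLeft (-1) (BKP.tauNext G k) * BKP.shiftRight 1 (BKP.tau G))
      = 2 * BKP.atLeft (BKP.tau G) * BKP.atRight (BKP.tauNext G k)
        - BKP.atLeft (BKP.tauNext G k) * BKP.atRight (BKP.tau G) := by
  ext1 d
  obtain ⟨α, β, rfl⟩ := BKP.exists_sumElim d
  have hprod : BKP.expXiDiff * BKP.shiftLeft (-1) (BKP.tauNext G k) * BKP.shiftRight 1 (BKP.tau G)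
      = MvPowerSeries.rename Function.Embedding.inl (BKP.expXi 1 *
          MvPowerSeries.map (HahnSeries.ofPowerSeries ℤ ℂ) (BKP.miwaShift (-1) (BKP.tauNext G k)))
        * MvPowerSeries.rename Function.Embedding.inr (BKP.expXi (-1) *
          MvPowerSeries.map (HahnSeries.ofPowerSeries ℤ ℂ) (BKP.miwaShift 1 (BKP.tau G))) := by
    rw [BKP.expXiDiff_eq, BKP.shiftLeft, BKP.shiftRight, ← MvPowerSeries.rename_map,
      ← MvPowerSeries.rename_map, map_mul, map_mul]
    ring
  -- The residue pairs the coefficients of `z^n` and `z^{-n}` of the two vertex operators.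
  have hleft : MvPowerSeries.coeff (Finsupp.sumElim α β)
      (BKP.residue (BKP.expXiDiff * BKP.shiftLeft (-1) (BKP.tauNext G k) *
        BKP.shiftRight 1 (BKP.tau G)))
      = ∑ᶠ n : ℤ, (2 * (2 * BKP.matrixElement (BKP.braφ k (BKP.braφ n (BKP.braZero
          (BKP.vacExp α)))) G (BKP.φ 0 • BKP.vacKet)))
        * ((-1 : ℂ) ^ n * (2 * BKP.matrixElement (BKP.braφ (-n) (BKP.braZero (BKP.vacExp β)))
          G BKP.vacKet)) := by
    show (MvPowerSeries.coeff (Finsupp.sumElim α β) (BKP.expXiDiff *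
      BKP.shiftLeft (-1) (BKP.tauNext G k) * BKP.shiftRight 1 (BKP.tau G))).coeff 0 = _
    rw [hprod, BKP.coeff_rename_mul_rename, BKP.coeff_zero_mul]
    refine finsum_congr fun n => ?_
    have hl := BKP.coeff_expXi_mul_miwaShift (Or.inl rfl)
      ((2 : ℂ) • BKP.matrixFunctional G (BKP.φ 0 • BKP.vacKet) ∘ₗ BKP.braφ k) α n
    have hr := BKP.coeff_expXi_mul_miwaShift (Or.inr rfl)
      (BKP.matrixFunctional G BKP.vacKet) β (-n)
    have hp : (-1 : ℂ) ^ (-n) = (-1 : ℂ) ^ n := by rw [zpow_neg, ← inv_zpow]; norm_num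
    rw [← BKP.tauNext_eq, ← BKP.braZero_hexp, ← BKP.vacExp_eq, one_zpow, one_mul] at hl
    rw [← BKP.tau_eq, ← BKP.braZero_hexp, ← BKP.vacExp_eq, neg_neg, neg_neg, hp] at hr
    rw [hl, hr]
    rfl
  have h2 : (2 : BKP.TwoTimeSeries ℂ) = MvPowerSeries.C 2 := (map_ofNat MvPowerSeries.C 2).symm
  rw [hleft, BKP.coeff_bilinear hG, map_sub, mul_assoc 2 (BKP.atLeft (BKP.tau G)), h2,
    MvPowerSeries.coeff_C_mul]
  simp only [BKP.atLeft, BKP.atRight, BKP.coeff_rename_mul_rename]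
  show _ = 2 * (BKP.matrixElement (BKP.vacExp α) G BKP.vacKet *
    (2 * BKP.matrixElement (BKP.braφ k (BKP.vacExp β)) G (BKP.φ 0 • BKP.vacKet)))
    - 2 * BKP.matrixElement (BKP.braφ k (BKP.vacExp α)) G (BKP.φ 0 • BKP.vacKet) *
      BKP.matrixElement (BKP.vacExp β) G BKP.vacKet
  ring
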